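/- Fix $T>0$, $\tfrac13<H<\tfrac12$ and $p\in\left(\tfrac1H,\tfrac1{1-2H}\right)$, and put $R(s,t)=\tfrac12\left(s^{2H}+t^{2H}-|t-s|^{2H}\right)$ for $s,t\in[0,T]$. Let $\mathcal W=\{\omega\in C([0,T],\mathbb R):\omega(0)=0\}$ with the supremum norm, and let $\mathbb P$ be the law on $\mathcal W$ of fractional Brownian motion with Hurst parameter $H$, i.e. the Gaussian measure on $\mathcal W$ under which the coordinate process $B_t(\omega)=\omega(t)$ is centered with covariance $R$. Let $\mathcal H\subset\mathcal W$ be the Cameron–Martin space of $\mathbb P$: the image of the closure of $\mathcal W^*$ in $L^2(\mathbb P)$ under $Jf=\int_{\mathcal W}\omega f(\omega)\,d\mathbb P(\omega)$, with $\langle Jf,Jg\rangle_{\mathcal H}=\langle f,g\rangle_{L^2(\mathbb P)}$; it contains $R(t,\cdot)=\mathbb E[B_tB_\cdot]$ for every $t\in[0,T]$. Let $\mathcal H^2=\mathcal H\times\mathcal H$ with $\|(h^1,h^2)\|_{\mathcal H^2}^2=\|h^1\|_{\mathcal H}^2+\|h^2\|_{\mathcal H}^2$. Let $\mathcal W_p$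 be the closure of $C^\infty([0,T],\mathbb R)\cap\mathcal W$ in the $p$-variation norm $\|f\|_p=\sup_{0=t_0<\dots<t_N=T}\left(\sum_i|f(t_i)-f(t_{i-1})|^p\right)^{1/p}$, and let $\mathcal W_p^2=\mathcal W_p\times\mathcal W_p$. For $\alpha\in\mathcal W_p$ let $\int_0^T\alpha(t)\,R(dt,\cdot)$ be the limit in $\mathcal H$ of the sums $\sum_i\alpha(c_i)\left[R(t_i,\cdot)-R(t_{i-1},\cdot)\right]$ with $c_i\in(t_{i-1},t_i)$, as the mesh of the partition $0=t_0<\dots<t_N=T$ tends to $0$. For $\omega=(\omega^1,\omega^2)\in\mathcal W_p^2$ put $\tilde\omega=(\omega^2,-\omega^1)$ and $$Q\omega=\tfrac12R(T,\cdot)\,\tilde\omega(T)-\int_0^T\tilde\omega(t)\,R(dt,\cdot)\in\mathcal H^2,\qquad \Phi(\omega)=T^{4H}\|Q\omega\|_{\mathcal H^2}^2-T^{2H}|Q\omega(T)|^2,$$ where the expressions are taken componentwise and $|\cdot|$ is the Euclidean norm on $\mathbb R^2$. Then the limits defining $\int_0^T\alpha(t)\,R(dt,\cdot)$ exist for all $\alpha\in\mathcal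 W_p$, so that $\Phi$ is well defined; $\Phi$ is a quadratic form on $\mathcal W_p^2$; it is positive semidefinite, i.e. $\Phi(\omega)\ge0$ for all $\omega\in\mathcal W_p^2$; and its null space is trivial, i.e. $\Phi(\omega)=0$ if and only if $\omega=0$. -/

import Mathlib

open MeasureTheory ProbabilityTheory Filter Topology Set
open scoped ENNReal

noncomputable section

/-! ## Cameron-Martin space of a Gaussian measure on a separable Banach space -/

section CameronMartin

variable {E : Type*} [NormedAddCommGroup E] [NormedSpace ℝ E] [CompleteSpace E]
  [SecondCountableTopology E] [MeasurableSpace E] [BorelSpace E]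

/-- The closure in `L²(P)` of the topological dual `E*` (functionals viewed as random variables). -/
def dualClosure (P : Measure E) : Submodule ℝ (Lp ℝ 2 P) :=
  (LinearMap.range (StrongDual.toLp (𝕜 := ℝ) P 2).toLinearMap).topologicalClosure

theorem integrable_smul_of_lp_two (P : Measure E) [IsGaussian P] (f : Lp ℝ 2 P) :
    Integrable (fun x : E => f x • x) P :=
  memLp_one_iff_integrable.1
    (MemLp.smul (p := 2) (q := 2) (r := 1) (IsGaussian.memLp_id P 2 (by norm_num)) (Lp.memLp f))

/-- The map `J f = ∫ x f(x) dP(x)` from `L²(P)` to `E` (a Bochner integral). -/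
def cmMap (P : Measure E) [IsGaussian P] : Lp ℝ 2 P →ₗ[ℝ] E where
  toFun f := ∫ x, f x • x ∂P
  map_add' f g := by
    rw [← integral_add (integrable_smul_of_lp_two P f) (integrable_smul_of_lp_two P g)]
    refine integral_congr_ae ?_
    filter_upwards [Lp.coeFn_add f g] with x hx
    rw [hx, Pi.add_apply, add_smul]
  map_smul' c f := by
    rw [RingHom.id_apply, ← integral_smul]
    refine integral_congr_ae ?_
    filter_upwards [Lp.coeFn_smul c f] with x hx
    rw [hx, Pi.smul_apply, smul_assoc]

theorem inner_toLp_eq (P : Measure E) [IsGaussian P] (L : StrongDual ℝ E) (f : Lp ℝ 2 P) :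
    inner ℝ (StrongDual.toLp P 2 L) f = L (cmMap P f) := by
  have hid : MemLp id 2 P := IsGaussian.memLp_id P 2 (by norm_num)
  change _ = L (∫ x, f x • x ∂P)
  rw [← ContinuousLinearMap.integral_comp_comm L (integrable_smul_of_lp_two P f), L2.inner_def,
    StrongDual.toLp_apply hid]
  refine integral_congr_ae ?_
  filter_upwards [MemLp.coeFn_toLp (hid.continuousLinearMap_comp L)] with x hx
  have hx' : MemLp.toLp (⇑L) (hid.continuousLinearMap_comp L) x = L x := hx
  rw [hx']
  simp

theorem dual_cmMap_toLp (P : Measure E) [IsGaussian P] (L M : StrongDual ℝ E) :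
    L (cmMap P (StrongDual.toLp P 2 M)) = ∫ x, M x * L x ∂P := by
  have hid : MemLp id 2 P := IsGaussian.memLp_id P 2 (by norm_num)
  change L (∫ x, (StrongDual.toLp P 2 M : Lp ℝ 2 P) x • x ∂P) = _
  rw [← ContinuousLinearMap.integral_comp_comm L (integrable_smul_of_lp_two P _),
    StrongDual.toLp_apply hid]
  refine integral_congr_ae ?_
  filter_upwards [MemLp.coeFn_toLp (hid.continuousLinearMap_comp M)] with x hx
  have hx' : MemLp.toLp (⇑M) (hid.continuousLinearMap_comp M) x = M x := hx
  rw [hx', map_smul, smul_eq_mul]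

/-- `J` restricted to the closure of `E*` in `L²(P)`. -/
def cmMapRestrict (P : Measure E) [IsGaussian P] : dualClosure P →ₗ[ℝ] E :=
  (cmMap P).domRestrict (dualClosure P)

theorem cmMapRestrict_injective (P : Measure E) [IsGaussian P] :
    Function.Injective (cmMapRestrict P) := by
  rw [← LinearMap.ker_eq_bot, LinearMap.ker_eq_bot']
  rintro ⟨f, hf⟩ h0
  have h0' : cmMap P f = 0 := h0
  have hperp : f ∈ (dualClosure P)ᗮ := by
    rw [dualClosure, Submodule.orthogonal_closure]
    rw [Submodule.mem_orthogonal]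
    rintro _ ⟨L, rfl⟩
    change inner ℝ (StrongDual.toLp P 2 L) f = 0
    rw [inner_toLp_eq, h0', map_zero]
  have : inner ℝ f f = 0 := (Submodule.mem_orthogonal _ _).1 hperp f hf
  exact Subtype.ext (inner_self_eq_zero.1 this)

/-- The Cameron-Martin space of `P`: the image under `J` of the closure of `E*` in `L²(P)`,
a linear subspace of `E`. It is a separate type because its norm is not the one of `E`. -/
def CameronMartin (P : Measure E) [IsGaussian P] : Type _ :=
  ↥(LinearMap.range (cmMapRestrict P))

instance instAddCommGroupCameronMartin (P : Measure E) [IsGaussian P] :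
    AddCommGroup (CameronMartin P) :=
  inferInstanceAs (AddCommGroup ↥(LinearMap.range (cmMapRestrict P)))

instance instModuleCameronMartin (P : Measure E) [IsGaussian P] : Module ℝ (CameronMartin P) :=
  inferInstanceAs (Module ℝ ↥(LinearMap.range (cmMapRestrict P)))

/-- The inclusion of the Cameron-Martin space in `E`. -/
def cmIncl (P : Measure E) [IsGaussian P] : CameronMartin P →ₗ[ℝ] E :=
  (LinearMap.range (cmMapRestrict P)).subtype

/-- `J` as a linear bijection onto the Cameron-Martin space. -/
def cmEquiv (P : Measure E) [IsGaussian P] : dualClosure P ≃ₗ[ℝ] CameronMartin P :=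
  LinearEquiv.ofInjective (cmMapRestrict P) (cmMapRestrict_injective P)

theorem cmIncl_cmEquiv (P : Measure E) [IsGaussian P] (f : dualClosure P) :
    cmIncl P (cmEquiv P f) = cmMap P f := rfl

/-- The norm `‖J f‖ = ‖f‖_{L²(P)}`. -/
instance instNormedAddCommGroupCameronMartin (P : Measure E) [IsGaussian P] :
    NormedAddCommGroup (CameronMartin P) :=
  NormedAddCommGroup.induced (CameronMartin P) (dualClosure P) (cmEquiv P).symm.toLinearMap
    (cmEquiv P).symm.injective

theorem norm_cameronMartin_eq (P : Measure E) [IsGaussian P] (h : CameronMartin P) :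
    ‖h‖ = ‖(cmEquiv P).symm h‖ := rfl

instance instNormedSpaceCameronMartin (P : Measure E) [IsGaussian P] :
    NormedSpace ℝ (CameronMartin P) where
  norm_smul_le c h := by
    rw [norm_cameronMartin_eq, norm_cameronMartin_eq, map_smul, norm_smul]

/-- The inner product `⟪J f, J g⟫ = ⟪f, g⟫_{L²(P)}`. -/
instance instInnerProductSpaceCameronMartin (P : Measure E) [IsGaussian P] :
    InnerProductSpace ℝ (CameronMartin P) where
  inner h k := inner ℝ ((cmEquiv P).symm h) ((cmEquiv P).symm k)
  norm_sq_eq_re_inner h := by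
    rw [norm_cameronMartin_eq]
    exact norm_sq_eq_re_inner _
  conj_inner_symm h k := inner_conj_symm _ _
  add_left h k l := by rw [map_add, inner_add_left]
  smul_left h k c := by
    rw [map_smul]
    exact real_inner_smul_left ((cmEquiv P).symm h) ((cmEquiv P).symm k) c

end CameronMartin

/-! ## The path space and the law of fractional Brownian motion -/

/-- The time `0` in `[0,T]`. -/
def timeZero (T : ℝ) [hT : Fact (0 < T)] : Icc (0 : ℝ) T := ⟨0, le_refl 0, hT.out.le⟩

/-- The time `T` in `[0,T]`. -/
def timeEnd (T : ℝ) [hT : Fact (0 < T)] : Icc (0 : ℝ) T := ⟨T, hT.out.le, le_refl T⟩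

/-- Continuous paths on `[0,T]` that start at `0`. -/
def wienerSubmodule (T : ℝ) [Fact (0 < T)] : Submodule ℝ C(Icc (0 : ℝ) T, ℝ) :=
  LinearMap.ker (ContinuousMap.evalCLM ℝ (timeZero T) : C(Icc (0 : ℝ) T, ℝ) →L[ℝ] ℝ).toLinearMap

/-- The path space `𝒲 = {ω ∈ C([0,T], ℝ) : ω 0 = 0}` with the sup norm. -/
abbrev WienerSpace (T : ℝ) [Fact (0 < T)] : Type := ↥(wienerSubmodule T)

instance instCompleteSpaceWiener (T : ℝ) [Fact (0 < T)] : CompleteSpace (WienerSpace T) :=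
  (ContinuousLinearMap.isClosed_ker
    (ContinuousMap.evalCLM ℝ (timeZero T) : C(Icc (0 : ℝ) T, ℝ) →L[ℝ] ℝ)).completeSpace_coe

instance instMeasurableSpaceWiener (T : ℝ) [Fact (0 < T)] : MeasurableSpace (WienerSpace T) :=
  borel _

instance instBorelSpaceWiener (T : ℝ) [Fact (0 < T)] : BorelSpace (WienerSpace T) := ⟨rfl⟩

/-- Evaluation `ω ↦ ω t`, the coordinate process. -/
def wienerEval (T : ℝ) [Fact (0 < T)] (t : Icc (0 : ℝ) T) : StrongDual ℝ (WienerSpace T) :=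
  (ContinuousMap.evalCLM ℝ t).comp (wienerSubmodule T).subtypeL

theorem wienerEval_apply (T : ℝ) [Fact (0 < T)] (t : Icc (0 : ℝ) T) (ω : WienerSpace T) :
    wienerEval T t ω = ω.1 t := rfl

/-- The covariance `R(s,t) = (s^{2H} + t^{2H} - |t-s|^{2H}) / 2`. -/
def fbmCov (H s t : ℝ) : ℝ := (s ^ (2 * H) + t ^ (2 * H) - |t - s| ^ (2 * H)) / 2

/-- The Gaussian measure `P` on the path space is the law of fractional Brownian motion with Hurst
parameter `H`: the coordinate process is centered and has covariance `R`. -/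
structure IsFBMLaw {T : ℝ} [Fact (0 < T)] (H : ℝ) (P : Measure (WienerSpace T)) [IsGaussian P] :
    Prop where
  mean_eq : ∀ t : Icc (0 : ℝ) T, ∫ ω, ω.1 t ∂P = 0
  cov_eq : ∀ s t : Icc (0 : ℝ) T, ∫ ω, ω.1 s * ω.1 t ∂P = fbmCov H s t

/-! ## Partitions, `p`-variation and the space `𝒲_p` -/

/-- A finite partition `0 = t_0 < t_1 < ... < t_N = T`. -/
structure IntervalPartition (T : ℝ) [Fact (0 < T)] where
  size : ℕ
  pt : Fin (size + 1) → Icc (0 : ℝ) T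
  strictMono : StrictMono pt
  first : pt 0 = timeZero T
  last : pt (Fin.last size) = timeEnd T

/-- A partition together with intermediate points `c_i ∈ (t_{i-1}, t_i)`. -/
structure TaggedIntervalPartition (T : ℝ) [Fact (0 < T)] extends IntervalPartition T where
  tag : Fin size → Icc (0 : ℝ) T
  tag_mem : ∀ i, tag i ∈ Ioo (pt i.castSucc) (pt i.succ)

/-- The mesh size: the maximal length of an interval of the partition. -/
def IntervalPartition.mesh {T : ℝ} [Fact (0 < T)] (π : IntervalPartition T) : ℝ :=
  ⨆ i : Fin π.size, ((π.pt i.succ : ℝ) - π.pt i.castSucc)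

/-- The filter of tagged partitions with mesh size tending to `0`. -/
def meshFilter (T : ℝ) [Fact (0 < T)] : Filter (TaggedIntervalPartition T) :=
  comap (fun π => π.toIntervalPartition.mesh) (𝓝 0)

/-- The `p`-variation `sup_Π (∑ |f(t_i) - f(t_{i-1})|^p)^{1/p}`, with values in `[0,∞]`. -/
def pVariation {T : ℝ} [Fact (0 < T)] (p : ℝ) (f : Icc (0 : ℝ) T → ℝ) : ℝ≥0∞ :=
  ⨆ π : IntervalPartition T,
    (∑ i : Fin π.size, ‖f (π.pt i.succ) - f (π.pt i.castSucc)‖ₑ ^ p) ^ (1 / p)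

theorem pVariation_add_le {T : ℝ} [Fact (0 < T)] {p : ℝ} (hp : 1 ≤ p)
    (f g : Icc (0 : ℝ) T → ℝ) :
    pVariation p (f + g) ≤ pVariation p f + pVariation p g := by
  refine iSup_le fun π => ?_
  refine le_trans ?_ (add_le_add (le_iSup (fun π : IntervalPartition T =>
    (∑ i : Fin π.size, ‖f (π.pt i.succ) - f (π.pt i.castSucc)‖ₑ ^ p) ^ (1 / p)) π)
    (le_iSup (fun π : IntervalPartition T =>
    (∑ i : Fin π.size, ‖g (π.pt i.succ) - g (π.pt i.castSucc)‖ₑ ^ p) ^ (1 / p)) π))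
  refine le_trans ?_ (ENNReal.Lp_add_le Finset.univ _ _ hp)
  have h1 : 0 ≤ p := by linarith
  gcongr with i
  rw [Pi.add_apply, Pi.add_apply, add_sub_add_comm]
  exact enorm_add_le _ _

theorem pVariation_const_mul {T : ℝ} [Fact (0 < T)] {p : ℝ} (hp : 1 ≤ p) (c : ℝ)
    (f : Icc (0 : ℝ) T → ℝ) : pVariation p (c • f) = ‖c‖ₑ * pVariation p f := by
  have h0 : 0 < p := by linarith
  unfold pVariation
  rw [ENNReal.mul_iSup]
  refine iSup_congr fun π => ?_
  have : ∀ i : Fin π.size, ‖(c • f) (π.pt i.succ) - (c • f) (π.pt i.castSucc)‖ₑ ^ p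
      = ‖c‖ₑ ^ p * ‖f (π.pt i.succ) - f (π.pt i.castSucc)‖ₑ ^ p := by
    intro i
    rw [Pi.smul_apply, Pi.smul_apply, smul_eq_mul, smul_eq_mul, ← mul_sub, enorm_mul,
      ENNReal.mul_rpow_of_nonneg _ _ h0.le]
  simp_rw [this]
  rw [← Finset.mul_sum, ENNReal.mul_rpow_of_nonneg _ _ (by positivity), ← ENNReal.rpow_mul,
    mul_one_div_cancel h0.ne', ENNReal.rpow_one]

/-- The smooth paths in the path space, `C^∞([0,T], ℝ) ∩ 𝒲`. -/
def smoothPaths (T : ℝ) [Fact (0 < T)] : Submodule ℝ (WienerSpace T) where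
  carrier := {ω | ∃ g : ℝ → ℝ, ContDiffOn ℝ ((⊤ : ℕ∞) : WithTop ℕ∞) g (Icc 0 T) ∧ ∀ t : Icc (0 : ℝ) T, ω.1 t = g t}
  add_mem' := by
    rintro ω η ⟨f, hf, hω⟩ ⟨g, hg, hη⟩
    exact ⟨fun x => f x + g x, hf.add hg, fun t => by simp [← hω, ← hη]⟩
  zero_mem' := ⟨fun _ => 0, contDiffOn_const, fun t => rfl⟩
  smul_mem' := by
    rintro c ω ⟨f, hf, hω⟩
    exact ⟨fun x => c * f x, contDiffOn_const.mul hf, fun t => by simp [← hω]⟩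

/-- The space `𝒲_p`: the closure of the smooth paths in the `p`-variation norm. -/
def WienerP (T p : ℝ) [Fact (0 < T)] [hp : Fact (1 ≤ p)] : Submodule ℝ (WienerSpace T) where
  carrier := {ω | ∀ ε : ℝ≥0∞, 0 < ε → ∃ g ∈ smoothPaths T, pVariation p ⇑(ω - g).1 < ε}
  add_mem' := by
    intro ω η hω hη ε hε
    obtain ⟨f, hf, hf'⟩ := hω (ε / 2) (ENNReal.half_pos hε.ne')
    obtain ⟨g, hg, hg'⟩ := hη (ε / 2) (ENNReal.half_pos hε.ne')
    refine ⟨f + g, add_mem hf hg, ?_⟩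
    have h1 : (⇑((ω + η) - (f + g)).1 : Icc (0 : ℝ) T → ℝ) = ⇑(ω - f).1 + ⇑(η - g).1 := by
      rw [add_sub_add_comm]
      rfl
    rw [h1]
    calc _ ≤ _ := pVariation_add_le hp.out _ _
      _ < ε / 2 + ε / 2 := ENNReal.add_lt_add hf' hg'
      _ = ε := ENNReal.add_halves ε
  zero_mem' := by
    intro ε hε
    refine ⟨0, zero_mem _, ?_⟩
    have h1 : (⇑((0 : WienerSpace T) - 0).1 : Icc (0 : ℝ) T → ℝ) = (0 : ℝ) • 0 := by
      ext t
      simp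
    rw [h1, pVariation_const_mul hp.out]
    simpa using hε
  smul_mem' := by
    intro c ω hω ε hε
    by_cases hc : c = 0
    · subst hc
      refine ⟨0, zero_mem _, ?_⟩
      have h1 : (⇑((0 : ℝ) • ω - 0).1 : Icc (0 : ℝ) T → ℝ) = (0 : ℝ) • 0 := by
        ext t
        simp
      rw [h1, pVariation_const_mul hp.out]
      simpa using hε
    have hc' : ‖c‖ₑ ≠ 0 := by simpa using hc
    obtain ⟨f, hf, hf'⟩ := hω (ε / ‖c‖ₑ) (ENNReal.div_pos hε.ne' enorm_ne_top)
    refine ⟨c • f, Submodule.smul_mem _ c hf, ?_⟩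
    have h1 : (⇑(c • ω - c • f).1 : Icc (0 : ℝ) T → ℝ) = c • ⇑(ω - f).1 := by
      ext t
      simp [mul_sub]
    rw [h1, pVariation_const_mul hp.out, mul_comm]
    exact (ENNReal.lt_div_iff_mul_lt (Or.inl hc') (Or.inl enorm_ne_top)).1 hf'

/-! ## The operator `Q` and the form `Φ` -/

section Form

variable {T : ℝ} [Fact (0 < T)]

/-- The element `R(t,·) = E[B_t B_·]` of the Cameron-Martin space. -/
def cmKernel (P : Measure (WienerSpace T)) [IsGaussian P] (t : Icc (0 : ℝ) T) : CameronMartin P :=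
  cmEquiv P ⟨StrongDual.toLp P 2 (wienerEval T t), by
    rw [dualClosure]
    exact Submodule.le_topologicalClosure _ ⟨wienerEval T t, rfl⟩⟩

theorem cmKernel_apply {H : ℝ} (P : Measure (WienerSpace T)) [IsGaussian P] (hP : IsFBMLaw H P)
    (t s : Icc (0 : ℝ) T) : (cmIncl P (cmKernel P t)).1 s = fbmCov H t s := by
  rw [← hP.cov_eq]
  exact dual_cmMap_toLp P (wienerEval T s) (wienerEval T t)

/-- The Riemann sum `∑ α(c_i) (R(t_i,·) - R(t_{i-1},·))` in the Cameron-Martin space. -/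
def cmRiemannSum (P : Measure (WienerSpace T)) [IsGaussian P] (α : Icc (0 : ℝ) T → ℝ)
    (π : TaggedIntervalPartition T) : CameronMartin P :=
  ∑ i : Fin π.size, α (π.tag i) • (cmKernel P (π.pt i.succ) - cmKernel P (π.pt i.castSucc))

instance instNonemptyCameronMartin (P : Measure (WienerSpace T)) [IsGaussian P] :
    Nonempty (CameronMartin P) := ⟨0⟩

/-- The integral `∫_0^T α(t) R(dt,·)`: the limit of the Riemann sums in the Cameron-Martin space as
the mesh size tends to `0`. -/
def cmIntegral (P : Measure (WienerSpace T)) [IsGaussian P] (α : Icc (0 : ℝ) T → ℝ) :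
    CameronMartin P :=
  limUnder (meshFilter T) (cmRiemannSum P α)

/-- One component `(1/2) α(T) R(T,·) - ∫_0^T α(t) R(dt,·)` of `Q`. -/
def qComponent (P : Measure (WienerSpace T)) [IsGaussian P] (α : WienerSpace T) :
    CameronMartin P :=
  ((1 / 2 : ℝ) * α.1 (timeEnd T)) • cmKernel P (timeEnd T) - cmIntegral P α.1

/-- `Q ω = (1/2) ω̃(T) R(T,·) - ∫_0^T ω̃(t) R(dt,·)`, where `ω̃ = (ω², -ω¹)`, with values in the
Hilbert sum of two copies of the Cameron-Martin space. -/
def opQ (P : Measure (WienerSpace T)) [IsGaussian P] {p : ℝ} [Fact (1 ≤ p)]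
    (ω : WienerP T p × WienerP T p) : WithLp 2 (CameronMartin P × CameronMartin P) :=
  WithLp.toLp 2 (qComponent P (ω.2 : WienerSpace T), qComponent P (-ω.1 : WienerSpace T))

/-- The value at time `T` of an element of `ℋ²`, as a vector of the Euclidean plane. -/
def endValue (P : Measure (WienerSpace T)) [IsGaussian P]
    (h : WithLp 2 (CameronMartin P × CameronMartin P)) : EuclideanSpace ℝ (Fin 2) :=
  !₂[(cmIncl P h.fst).1 (timeEnd T), (cmIncl P h.snd).1 (timeEnd T)]

/-- The form `Φ(ω) = T^{4H} ‖Qω‖² - T^{2H} |Qω(T)|²`. -/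
def formPhi (H : ℝ) (P : Measure (WienerSpace T)) [IsGaussian P] {p : ℝ} [Fact (1 ≤ p)]
    (ω : WienerP T p × WienerP T p) : ℝ :=
  T ^ (4 * H) * ‖opQ P ω‖ ^ 2 - T ^ (2 * H) * ‖endValue P (opQ P ω)‖ ^ 2

end Form

end

open MeasureTheory ProbabilityTheory Filter Topology Set
open scoped ENNReal

/-! For `0 < H < 1/2` the Cameron–Martin norm of a finite sum `∑ a_t R(t,·)` is, up to the constant
`gagliardoConst H`, the Gagliardo seminorm of order `1/2 - H` of the step function `∑ a_t
1_{(0,t]}`. The seminorm of `1_{(s,t]}` is a direct computation and gives `C (t-s)^{2H}`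
(`gagliardo_indicator`); polarisation turns this into the covariance `R` (`inner_shiftLp`), and
bilinearity does the rest (`norm_linearCombination_cmKernel_sq`). Thus `∫ α(t) R(dt,·)` stands for
the function `α 1_{(0,T]}`.

Existence. The step function of a Riemann sum is `α ∘ τ` with `τ` monotone, cut off at `T`, so its
`L²` increments of step `h` are `O(h^{2/p})` uniformly in the partition (`shiftSq_riemann_le`).
Since `2/p > 1 - 2H`, the part of the seminorm over small `h` is uniformly small; the part over
large `h` is controlled by the `L²` norm, and the step functions converge uniformly to `α` on
`(0,T]`. Hence the Riemann sums are Cauchy in a complete space.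

The form. As `h(T) = ⟨R(T,·), h⟩` and `‖R(T,·)‖² = T^{2H}`, the expression `T^{4H} ‖h‖² - T^{2H}
h(T)²` equals `‖T^{2H} h - h(T) R(T,·)‖²`, the defect in Cauchy–Schwarz (`norm_orthPart_sq`). So `Φ`
is a sum of two squared norms of linear maps: it is quadratic and nonnegative.

Null space. If `Φ` vanishes, each integral is a multiple `c R(T,·)`. The Gagliardo seminorm
dominates the `L²` norm of functions supported in `(0,T]` (`lintegral_sq_le_gagliardo`), so `α = c`
almost everywhere, then everywhere by continuity, and `α(0) = 0` forces `c = 0`. -/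

noncomputable section

/-! ## The Gagliardo seminorm of order `1/2 - H` -/

/-- The squared `L²` norm of the increment `f(· + h) - f`. -/
def shiftSq (f : ℝ → ℝ) (h : ℝ) : ℝ≥0∞ := ∫⁻ x, ‖f (x + h) - f x‖ₑ ^ 2

/-- The squared Gagliardo seminorm of order `1/2 - H`. -/
def gagliardo (H : ℝ) (f : ℝ → ℝ) : ℝ≥0∞ :=
  ∫⁻ h in Ioi (0 : ℝ), ENNReal.ofReal (h ^ (2 * H - 2)) * shiftSq f h

theorem lintegral_rpow_Ioi {r c : ℝ} (hr : r < -1) (hc : 0 < c) :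
    ∫⁻ h in Ioi c, ENNReal.ofReal (h ^ r) = ENNReal.ofReal (-c ^ (r + 1) / (r + 1)) := by
  rw [← integral_Ioi_rpow_of_lt hr hc, ofReal_integral_eq_lintegral_ofReal
    (integrableOn_Ioi_rpow_of_lt hr hc)]
  filter_upwards [ae_restrict_mem measurableSet_Ioi] with x hx
  exact Real.rpow_nonneg (hc.trans hx).le _

theorem lintegral_rpow_Ioc {r c : ℝ} (hr : -1 < r) (hc : 0 ≤ c) :
    ∫⁻ h in Ioc 0 c, ENNReal.ofReal (h ^ r) = ENNReal.ofReal (c ^ (r + 1) / (r + 1)) := by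
  have h1 := integral_rpow (a := 0) (b := c) (Or.inl hr)
  rw [Real.zero_rpow (by linarith), sub_zero] at h1
  rw [← h1, intervalIntegral.integral_of_le hc, ofReal_integral_eq_lintegral_ofReal
    ((intervalIntegrable_iff_integrableOn_Ioc_of_le hc).1
      (intervalIntegral.intervalIntegrable_rpow' hr))]
  filter_upwards [ae_restrict_mem measurableSet_Ioc] with x hx
  exact Real.rpow_nonneg hx.1.le _

theorem lintegral_Ioi_split {c : ℝ} (hc : 0 ≤ c) (g : ℝ → ℝ≥0∞) :
    ∫⁻ h in Ioi 0, g h = (∫⁻ h in Ioc 0 c, g h) + ∫⁻ h in Ioi c, g h := by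
  rw [← Ioc_union_Ioi_eq_Ioi hc, lintegral_union measurableSet_Ioi]
  rw [Set.disjoint_left]
  intro x hx hx'
  exact absurd hx.2 (not_le.2 hx')

/-- The increment has modulus one exactly on two disjoint intervals: around the two endpoints, of
length `h`, when `h ≤ b - a`; otherwise the interval and its translate, of length `b - a`. -/
theorem shiftSq_indicator {a b h : ℝ} (hab : a ≤ b) (hh : 0 ≤ h) :
    shiftSq ((Ioc a b).indicator 1) h = ENNReal.ofReal (2 * min h (b - a)) := by
  have key : ∀ s t : Set ℝ, MeasurableSet s → MeasurableSet t → Disjoint s t →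
      (∀ x, ‖(Ioc a b).indicator (1 : ℝ → ℝ) (x + h) - (Ioc a b).indicator 1 x‖ₑ ^ 2
        = (s ∪ t).indicator 1 x) →
      shiftSq ((Ioc a b).indicator 1) h = volume s + volume t := by
    intro s t hs ht hd he
    rw [shiftSq, lintegral_congr he, lintegral_indicator_one (hs.union ht),
      measure_union hd ht]
  rcases le_total h (b - a) with hc | hc
  · rw [key (Ioc (a - h) a) (Ioc (b - h) b) measurableSet_Ioc measurableSet_Ioc]
    · rw [Real.volume_Ioc, Real.volume_Ioc, ← ENNReal.ofReal_add (by linarith) (by linarith),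
        min_eq_left hc]
      congr 1
      ring
    · rw [Set.disjoint_left]
      rintro x ⟨h1, h2⟩ ⟨h3, h4⟩
      linarith
    · intro x
      simp only [indicator, mem_Ioc, mem_union, Pi.one_apply]
      split_ifs <;> first | (exfalso; grind) | simp
  · rw [key (Ioc (a - h) (b - h)) (Ioc a b) measurableSet_Ioc measurableSet_Ioc]
    · rw [Real.volume_Ioc, Real.volume_Ioc, ← ENNReal.ofReal_add (by linarith) (by linarith),
        min_eq_right hc]
      congr 1
      ring
    · rw [Set.disjoint_left]
      rintro x ⟨h1, h2⟩ ⟨h3, h4⟩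
      linarith
    · intro x
      simp only [indicator, mem_Ioc, mem_union, Pi.one_apply]
      split_ifs <;> first | (exfalso; grind) | simp

/-- The squared Gagliardo seminorm of the indicator of an interval of unit length. -/
def gagliardoConst (H : ℝ) : ℝ := 2 * (1 / (2 * H) + 1 / (1 - 2 * H))

theorem gagliardoConst_pos {H : ℝ} (hH : 0 < H) (hH' : H < 1 / 2) : 0 < gagliardoConst H := by
  have : 0 < 1 - 2 * H := by linarith
  unfold gagliardoConst
  positivity

/-- With `c = b - a`, the integrand is `2 h^{2H-1}` up to `c` and `2c h^{2H-2}` beyond. The first is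
integrable at zero because `H > 0`, the second at infinity because `H < 1/2`; both integrals are
multiples of `c^{2H}`. -/
theorem gagliardo_indicator {H a b : ℝ} (hH : 0 < H) (hH' : H < 1 / 2) (hab : a ≤ b) :
    gagliardo H ((Ioc a b).indicator 1)
      = ENNReal.ofReal (gagliardoConst H * (b - a) ^ (2 * H)) := by
  rcases hab.eq_or_lt with rfl | hlt
  · have : gagliardo H ((Ioc a a).indicator 1) = 0 := by simp [gagliardo, shiftSq]
    rw [this, sub_self, Real.zero_rpow (by linarith)]
    simp
  set c := b - a with hc
  have hc0 : 0 < c := by linarith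
  have h1 : ∫⁻ h in Ioc 0 c, ENNReal.ofReal (h ^ (2 * H - 2))
        * shiftSq ((Ioc a b).indicator 1) h
      = ENNReal.ofReal 2 * ENNReal.ofReal (c ^ (2 * H - 1 + 1) / (2 * H - 1 + 1)) := by
    rw [← lintegral_rpow_Ioc (by linarith) hc0.le, ← lintegral_const_mul' _ _ ENNReal.ofReal_ne_top]
    refine setLIntegral_congr_fun measurableSet_Ioc fun h hh => ?_
    rw [shiftSq_indicator hab hh.1.le, min_eq_left hh.2, ← ENNReal.ofReal_mul (Real.rpow_nonneg hh.1.le _),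
      ← ENNReal.ofReal_mul (by norm_num),
      show 2 * H - 1 = (2 * H - 2) + 1 by ring, Real.rpow_add_one hh.1.ne']
    congr 1
    ring
  have h2 : ∫⁻ h in Ioi c, ENNReal.ofReal (h ^ (2 * H - 2))
        * shiftSq ((Ioc a b).indicator 1) h
      = ENNReal.ofReal (2 * c) * ENNReal.ofReal (-c ^ (2 * H - 2 + 1) / (2 * H - 2 + 1)) := by
    rw [← lintegral_rpow_Ioi (by linarith) hc0, ← lintegral_const_mul' _ _ ENNReal.ofReal_ne_top]
    refine setLIntegral_congr_fun measurableSet_Ioi fun h hh => ?_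
    rw [shiftSq_indicator hab (hc0.trans hh).le, min_eq_right (le_of_lt hh), mul_comm]
  rw [gagliardo, lintegral_Ioi_split hc0.le, h1, h2, ← ENNReal.ofReal_mul (by norm_num),
    ← ENNReal.ofReal_mul (by positivity), ← ENNReal.ofReal_add]
  · congr 1
    rw [show 2 * H - 2 + 1 = 2 * H - 1 by ring, Real.rpow_sub_one hc0.ne',
      show 2 * H - 1 + 1 = 2 * H by ring, gagliardoConst]
    have h3 : (1 - 2 * H) ≠ 0 := by linarith
    have h4 : (2 * H - 1) ≠ 0 := by linarith
    field_simp
    ring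
  · have : 0 < 2 * H - 1 + 1 := by linarith
    positivity
  · have h5 : -c ^ (2 * H - 2 + 1) / (2 * H - 2 + 1) = c ^ (2 * H - 2 + 1) / (1 - 2 * H) := by
      rw [show 2 * H - 2 + 1 = -(1 - 2 * H) by ring, neg_div_neg_eq]
    have : 0 < 1 - 2 * H := by linarith
    rw [h5]
    positivity

/-! ### Comparison of increments, `L²` norm and Gagliardo seminorm. -/

theorem enorm_add_sq_le (a b : ℝ) : ‖a + b‖ₑ ^ 2 ≤ 2 * ‖a‖ₑ ^ 2 + 2 * ‖b‖ₑ ^ 2 := by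
  simp only [Real.enorm_eq_ofReal_abs]
  rw [← ENNReal.ofReal_pow (abs_nonneg _), ← ENNReal.ofReal_pow (abs_nonneg _),
    ← ENNReal.ofReal_pow (abs_nonneg _), ← ENNReal.ofReal_ofNat 2,
    ← ENNReal.ofReal_mul (by norm_num), ← ENNReal.ofReal_mul (by norm_num),
    ← ENNReal.ofReal_add (by positivity) (by positivity)]
  apply ENNReal.ofReal_le_ofReal
  rw [sq_abs, sq_abs, sq_abs]
  nlinarith [sq_nonneg (a - b)]

theorem shiftSq_add_le {f g : ℝ → ℝ} (hf : Measurable f) (h : ℝ) :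
    shiftSq (f + g) h ≤ 2 * shiftSq f h + 2 * shiftSq g h := by
  have hm : Measurable fun x => ‖f (x + h) - f x‖ₑ ^ 2 := by fun_prop
  rw [shiftSq, shiftSq, shiftSq, ← lintegral_const_mul' _ _ (by norm_num),
    ← lintegral_const_mul' _ _ (by norm_num), ← lintegral_add_left (hm.const_mul _)]
  refine lintegral_mono fun x => ?_
  have : (f + g) (x + h) - (f + g) x = (f (x + h) - f x) + (g (x + h) - g x) := by
    simp only [Pi.add_apply]
    ring
  rw [this]
  exact enorm_add_sq_le _ _

theorem shiftSq_const_mul (c : ℝ) (f : ℝ → ℝ) (h : ℝ) :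
    shiftSq (c • f) h = ‖c‖ₑ ^ 2 * shiftSq f h := by
  rw [shiftSq, shiftSq, ← lintegral_const_mul' _ _ (by simp)]
  refine lintegral_congr fun x => ?_
  rw [Pi.smul_apply, Pi.smul_apply, smul_eq_mul, smul_eq_mul, ← mul_sub, enorm_mul, mul_pow]

theorem shiftSq_sub_le {f g : ℝ → ℝ} (hf : Measurable f) (h : ℝ) :
    shiftSq (f - g) h ≤ 2 * shiftSq f h + 2 * shiftSq g h := by
  have h1 : shiftSq ((-1 : ℝ) • g) h = shiftSq g h := by
    rw [shiftSq_const_mul]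
    simp
  rw [← h1, show f - g = f + (-1 : ℝ) • g by rw [neg_one_smul, sub_eq_add_neg]]
  exact shiftSq_add_le hf h

theorem shiftSq_le_lintegral_sq {f : ℝ → ℝ} (hf : Measurable f) (h : ℝ) :
    shiftSq f h ≤ 4 * ∫⁻ x, ‖f x‖ₑ ^ 2 := by
  have hm : Measurable fun x => ‖f (x + h)‖ₑ ^ 2 := by fun_prop
  calc shiftSq f h ≤ ∫⁻ x, (2 * ‖f (x + h)‖ₑ ^ 2 + 2 * ‖f x‖ₑ ^ 2) := by
        refine lintegral_mono fun x => ?_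
        simp only [sub_eq_add_neg]
        refine (enorm_add_sq_le _ _).trans_eq ?_
        rw [enorm_neg]
    _ = (2 * ∫⁻ x, ‖f x‖ₑ ^ 2) + 2 * ∫⁻ x, ‖f x‖ₑ ^ 2 := by
        rw [lintegral_add_left (hm.const_mul _), lintegral_const_mul' _ _ (by norm_num),
          lintegral_const_mul' _ _ (by norm_num),
          lintegral_add_right_eq_self (fun x => ‖f x‖ₑ ^ 2) h]
    _ = 4 * ∫⁻ x, ‖f x‖ₑ ^ 2 := by
        rw [← add_mul]
        norm_num

/-- For `H < 1/2` the Gagliardo seminorm dominates the `L²` norm of functions supported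
in `(0,T]`. -/
theorem lintegral_sq_le_gagliardo {H T : ℝ} (hH' : H < 1 / 2) (hT : 0 < T) {f : ℝ → ℝ}
    (hf : ∀ x, x ∉ Ioc 0 T → f x = 0) :
    ENNReal.ofReal ((2 * T) ^ (2 * H - 2) * T) * ∫⁻ x, ‖f x‖ₑ ^ 2 ≤ gagliardo H f := by
  -- A shift by more than `T` moves the support off itself, so the increment alone already carries
  -- the `L²` norm of `f`. The constant is the smallest weight on `(T, 2T]` times the length `T`.
  have h1 : ∀ h ∈ Ioc T (2 * T), ENNReal.ofReal ((2 * T) ^ (2 * H - 2)) * ∫⁻ x, ‖f x‖ₑ ^ 2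
      ≤ ENNReal.ofReal (h ^ (2 * H - 2)) * shiftSq f h := by
    intro h hh
    have h0 : 0 < h := hT.trans hh.1
    gcongr ?_ * ?_
    · exact ENNReal.ofReal_le_ofReal
        (Real.rpow_le_rpow_of_nonpos h0 hh.2 (by linarith))
    · refine lintegral_mono fun x => ?_
      by_cases hx : x ∈ Ioc 0 T
      · rw [hf (x + h) (fun h' => by linarith [h'.2, hx.1, hh.1]), zero_sub, enorm_neg]
      · simp [hf x hx]
  calc _ = ∫⁻ h in Ioc T (2 * T), ENNReal.ofReal ((2 * T) ^ (2 * H - 2)) * ∫⁻ x, ‖f x‖ₑ ^ 2 := by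
        rw [setLIntegral_const, Real.volume_Ioc, ENNReal.ofReal_mul (by positivity),
          show 2 * T - T = T by ring]
        ring
    _ ≤ ∫⁻ h in Ioc T (2 * T), ENNReal.ofReal (h ^ (2 * H - 2)) * shiftSq f h :=
        setLIntegral_mono' measurableSet_Ioc h1
    _ ≤ gagliardo H f := lintegral_mono_set fun h hh => hT.trans hh.1

/-- Splitting the Gagliardo seminorm at `h = δ`. -/
theorem gagliardo_le_of_shiftSq_le {H κ δ A : ℝ} (hH' : H < 1 / 2) (hκ : 1 - 2 * H < κ)
    (hδ : 0 < δ) (hA : 0 ≤ A) {f : ℝ → ℝ} (hf : Measurable f)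
    (hs : ∀ h ∈ Ioc 0 δ, shiftSq f h ≤ ENNReal.ofReal (A * h ^ κ)) :
    gagliardo H f ≤ ENNReal.ofReal (A * (δ ^ (2 * H - 1 + κ) / (2 * H - 1 + κ)))
      + ENNReal.ofReal (δ ^ (2 * H - 1) / (1 - 2 * H)) * (4 * ∫⁻ x, ‖f x‖ₑ ^ 2) := by
  rw [gagliardo, lintegral_Ioi_split hδ.le]
  gcongr ?_ + ?_
  -- The exponent `2H - 2 + κ` exceeds `-1`, so the bound on the increments beats the singular
  -- weight.
  · calc _ ≤ ∫⁻ h in Ioc 0 δ, ENNReal.ofReal A * ENNReal.ofReal (h ^ (2 * H - 2 + κ)) := by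
          refine setLIntegral_mono' measurableSet_Ioc fun h hh => ?_
          calc _ ≤ ENNReal.ofReal (h ^ (2 * H - 2)) * ENNReal.ofReal (A * h ^ κ) := by
                gcongr
                exact hs h hh
            _ = _ := by
                rw [← ENNReal.ofReal_mul (Real.rpow_nonneg hh.1.le _), ← ENNReal.ofReal_mul hA,
                  Real.rpow_add hh.1]
                congr 1
                ring
      _ = _ := by
          rw [lintegral_const_mul' _ _ ENNReal.ofReal_ne_top,
            lintegral_rpow_Ioc (by linarith) hδ.le, ← ENNReal.ofReal_mul hA,
            show 2 * H - 2 + κ + 1 = 2 * H - 1 + κ by ring]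
  · calc _ ≤ ∫⁻ h in Ioi δ, ENNReal.ofReal (h ^ (2 * H - 2)) * (4 * ∫⁻ x, ‖f x‖ₑ ^ 2) := by
          refine lintegral_mono fun h => ?_
          gcongr
          exact shiftSq_le_lintegral_sq hf h
      _ = _ := by
          rw [lintegral_mul_const _ (by fun_prop), lintegral_rpow_Ioi (by linarith) hδ,
            show 2 * H - 2 + 1 = -(1 - 2 * H) by ring, neg_div_neg_eq,
            show -(1 - 2 * H) = 2 * H - 1 by ring]

/-! ## Increments of paths of finite `p`-variation -/

section Variation

variable {T : ℝ} [Fact (0 < T)]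

/-- Removing repetitions from a finite monotone sequence. -/
theorem exists_strictMono_of_monotone {α : Type*} [LinearOrder α] (G : α → α → ℝ≥0∞)
    (hG : ∀ a, G a a = 0) (u : ℕ → α) (hu : Monotone u) (n : ℕ) :
    ∃ (m : ℕ) (v : Fin (m + 1) → α), StrictMono v ∧ v 0 = u 0 ∧ v (Fin.last m) = u n ∧
      ∑ k ∈ Finset.range n, G (u k) (u (k + 1)) = ∑ i : Fin m, G (v i.castSucc) (v i.succ) := by
  induction n with
  | zero =>
    exact ⟨0, fun _ => u 0, fun i j hij => absurd hij (by omega), rfl, rfl, by simp⟩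
  | succ n ih =>
    obtain ⟨m, v, hv, h0, hl, hs⟩ := ih
    rcases (hu n.le_succ).eq_or_lt with he | hlt
    · refine ⟨m, v, hv, h0, hl.trans he, ?_⟩
      have he' : u (n + 1) = u n := he.symm
      rw [Finset.sum_range_succ, he', hG, add_zero, hs]
    · refine ⟨m + 1, Fin.snoc v (u (n + 1)), ?_, ?_, ?_, ?_⟩
      · rw [Fin.strictMono_iff_lt_succ]
        intro i
        refine Fin.lastCases ?_ (fun j => ?_) i
        · rw [Fin.snoc_castSucc, Fin.succ_last, Fin.snoc_last, hl]
          exact hlt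
        · rw [Fin.snoc_castSucc, ← Fin.castSucc_succ, Fin.snoc_castSucc]
          exact hv j.castSucc_lt_succ
      · rw [← Fin.castSucc_zero, Fin.snoc_castSucc, h0]
      · rw [Fin.snoc_last]
      · rw [Finset.sum_range_succ, hs, Fin.sum_univ_castSucc]
        congr 1
        · refine Finset.sum_congr rfl fun j _ => ?_
          rw [Fin.snoc_castSucc, ← Fin.castSucc_succ, Fin.snoc_castSucc]
        · rw [Fin.snoc_castSucc, Fin.succ_last, Fin.snoc_last, hl]

/-- The supremum in `pVariation` runs over strictly increasing sequences; repeated points contribute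
zero and can be dropped. -/
theorem sum_enorm_rpow_le_of_endpoints {p : ℝ} (hp : 0 < p) (α : Icc (0 : ℝ) T → ℝ)
    (u : ℕ → Icc (0 : ℝ) T) (hu : Monotone u) (n : ℕ) (h0 : u 0 = timeZero T)
    (hn : u n = timeEnd T) :
    ∑ k ∈ Finset.range n, ‖α (u (k + 1)) - α (u k)‖ₑ ^ p ≤ pVariation p α ^ p := by
  obtain ⟨m, v, hv, hv0, hvl, hs⟩ := exists_strictMono_of_monotone
    (fun a b => ‖α b - α a‖ₑ ^ p) (fun a => by simp [hp]) u hu n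
  rw [hs]
  have h1 := le_iSup (fun π : IntervalPartition T =>
    (∑ i : Fin π.size, ‖α (π.pt i.succ) - α (π.pt i.castSucc)‖ₑ ^ p) ^ (1 / p))
    ⟨m, v, hv, hv0.trans h0, hvl.trans hn⟩
  have h2 := ENNReal.rpow_le_rpow h1 hp.le
  rwa [← ENNReal.rpow_mul, one_div_mul_cancel hp.ne', ENNReal.rpow_one] at h2

theorem sum_enorm_rpow_le_pVariation {p : ℝ} (hp : 0 < p) (α : Icc (0 : ℝ) T → ℝ)
    (u : ℕ → Icc (0 : ℝ) T) (hu : Monotone u) (n : ℕ) :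
    ∑ k ∈ Finset.range n, ‖α (u (k + 1)) - α (u k)‖ₑ ^ p ≤ pVariation p α ^ p := by
  -- Pad the sequence by `0` in front and `T` behind: `w (k + 1) = u k` for `k ≤ n` and `w (n + 2) =
  -- T`. The two extra increments only enlarge the sum.
  set w : ℕ → Icc (0 : ℝ) T := fun k =>
    if k = 0 then timeZero T else if n + 1 < k then timeEnd T else u (k - 1) with hw
  have hw1 : ∀ k ≤ n, w (k + 1) = u k := by
    intro k hk
    simp only [hw]
    rw [if_neg (by omega), if_neg (by omega), Nat.add_sub_cancel]
  have hmono : Monotone w := by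
    refine monotone_nat_of_le_succ fun k => ?_
    rcases Nat.eq_zero_or_pos k with rfl | hk
    · exact (w 1).2.1
    · simp only [hw]
      rw [if_neg (by omega : k ≠ 0), if_neg (by omega : k + 1 ≠ 0)]
      split_ifs
      · exact le_refl _
      · omega
      · exact (u (k - 1)).2.2
      · exact hu (by omega)
  refine le_trans ?_ (sum_enorm_rpow_le_of_endpoints hp α w hmono (n + 2) (by simp [hw])
    (by simp [hw]))
  rw [Finset.sum_range_succ, Finset.sum_range_succ']
  refine le_trans ?_ (le_trans (le_add_right le_rfl) (le_add_right le_rfl))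
  refine (Finset.sum_congr rfl fun k hk => ?_).le
  have hk := Finset.mem_range.1 hk
  rw [hw1 (k + 1) (by omega), hw1 k (by omega)]

/-- Along an arithmetic progression the increments of `α ∘ τ`, `τ` monotone, are controlled by the
`p`-variation of `α`. -/
theorem tsum_enorm_rpow_le_pVariation {p : ℝ} (hp : 0 < p) (α : Icc (0 : ℝ) T → ℝ)
    (τ : ℝ → Icc (0 : ℝ) T) (hτ : Monotone τ) {h : ℝ} (hh : 0 ≤ h) (x : ℝ) :
    ∑' k : ℤ, ‖α (τ (x + k • h + h)) - α (τ (x + k • h))‖ₑ ^ p ≤ pVariation p α ^ p := by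
  rw [ENNReal.tsum_eq_iSup_sum]
  refine iSup_le fun s => ?_
  obtain ⟨N, hN⟩ : ∃ N : ℕ, ∀ k ∈ s, -(N : ℤ) ≤ k ∧ k < N := by
    refine ⟨s.sup Int.natAbs + 1, fun k hk => ?_⟩
    have := Finset.le_sup (f := Int.natAbs) hk
    omega
  set u : ℕ → Icc (0 : ℝ) T := fun j => τ (x + ((j : ℤ) - (N : ℤ)) • h) with hu
  have hum : Monotone u := by
    intro i j hij
    refine hτ ?_
    have : ((i : ℤ) - (N : ℤ)) ≤ (j : ℤ) - (N : ℤ) := by omega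
    gcongr
  refine le_trans ?_ (sum_enorm_rpow_le_pVariation hp α u hum (2 * N))
  have hinj : ∀ j ∈ Finset.range (2 * N), ∀ j' ∈ Finset.range (2 * N),
      (j : ℤ) - (N : ℤ) = (j' : ℤ) - (N : ℤ) → j = j' := by
    intro j _ j' _ he
    omega
  have himg : s ⊆ (Finset.range (2 * N)).image (fun j : ℕ => (j : ℤ) - (N : ℤ)) := by
    intro k hk
    obtain ⟨h1, h2⟩ := hN k hk
    refine Finset.mem_image.2 ⟨(k + N).toNat, Finset.mem_range.2 (by omega), ?_⟩
    show (((k + N).toNat : ℕ) : ℤ) - (N : ℤ) = k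
    omega
  refine (Finset.sum_le_sum_of_subset himg).trans ?_
  rw [Finset.sum_image hinj]
  refine (Finset.sum_congr rfl fun j _ => ?_).le
  have : x + ((j : ℤ) - (N : ℤ)) • h + h = x + (((j + 1 : ℕ) : ℤ) - (N : ℤ)) • h := by
    simp only [zsmul_eq_mul]
    push_cast
    ring
  rw [this]

/-- Cut the line into cells of length `h`, translate all of them to `(0,h]` and exchange sum and
integral. At each `x` the sum runs along the progression `x + hℤ`, hence is at most the
`p`-variation to the power `p`, and `(0,h]` has length `h`. -/
theorem lintegral_enorm_rpow_shift_le {p : ℝ} (hp : 0 < p) {α : Icc (0 : ℝ) T → ℝ}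
    {τ : ℝ → Icc (0 : ℝ) T} (hτ : Monotone τ) (hm : Measurable fun x => α (τ x)) {h : ℝ}
    (hh : 0 < h) :
    ∫⁻ x, ‖α (τ (x + h)) - α (τ x)‖ₑ ^ p ≤ ENNReal.ofReal h * pVariation p α ^ p := by
  set F : ℝ → ℝ≥0∞ := fun x => ‖α (τ (x + h)) - α (τ x)‖ₑ ^ p with hF
  have hFm : Measurable F := by
    have h1 : Measurable fun x => α (τ (x + h)) := hm.comp (measurable_add_const h)
    exact ((h1.sub hm).enorm).pow_const p
  rw [← setLIntegral_univ F, ← iUnion_Ioc_add_zsmul hh 0, lintegral_iUnion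
    (fun _ => measurableSet_Ioc) (pairwise_disjoint_Ioc_add_zsmul 0 h)]
  have h1 : ∀ k : ℤ, ∫⁻ x in Ioc (0 + k • h) (0 + (k + 1) • h), F x
      = ∫⁻ x in Ioc 0 h, F (x + k • h) := by
    intro k
    rw [← lintegral_indicator measurableSet_Ioc, ← lintegral_indicator measurableSet_Ioc,
      ← lintegral_add_right_eq_self _ (k • h)]
    refine lintegral_congr fun x => ?_
    simp only [indicator, mem_Ioc, add_smul, one_smul, zero_add]
    refine if_congr ?_ rfl rfl
    constructor <;> rintro ⟨h1, h2⟩ <;> constructor <;> linarith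
  simp_rw [h1]
  rw [← lintegral_tsum (f := fun (k : ℤ) x => F (x + k • h))
    fun k => (hFm.comp (measurable_add_const _)).aemeasurable]
  calc _ ≤ ∫⁻ x in Ioc 0 h, pVariation p α ^ p := by
        refine lintegral_mono fun x => ?_
        exact tsum_enorm_rpow_le_pVariation hp α τ hτ hh.le x
    _ = _ := by
        rw [setLIntegral_const, Real.volume_Ioc, sub_zero, mul_comm]

end Variation

/-! ## The Cameron-Martin norm of step integrals -/

section Isometry

/-- The measure `h^{2H-2} dh dx` on `(0,∞) × ℝ`. -/
def shiftMeasure (H : ℝ) : Measure (ℝ × ℝ) :=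
  ((volume.restrict (Ioi 0)).withDensity fun h => ENNReal.ofReal (h ^ (2 * H - 2))).prod volume

/-- The increments of `f` as a function of the step size and the starting point. -/
def shiftDiff : (ℝ → ℝ) →ₗ[ℝ] (ℝ × ℝ → ℝ) where
  toFun f z := f (z.2 + z.1) - f z.2
  map_add' f g := by
    ext z
    simp only [Pi.add_apply]
    ring
  map_smul' c f := by
    ext z
    simp [mul_sub]

theorem measurable_shiftDiff {f : ℝ → ℝ} (hf : Measurable f) : Measurable (shiftDiff f) :=
  (hf.comp (measurable_snd.add measurable_fst)).sub (hf.comp measurable_snd)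

/-- Tonelli. This presents the Gagliardo seminorm as an `L²` norm, which makes polarisation
available. -/
theorem lintegral_shiftDiff {f : ℝ → ℝ} (hf : Measurable f) (H : ℝ) :
    ∫⁻ z, ‖shiftDiff f z‖ₑ ^ 2 ∂(shiftMeasure H) = gagliardo H f := by
  have hm : Measurable fun z => ‖shiftDiff f z‖ₑ ^ 2 :=
    (measurable_shiftDiff hf).enorm.pow_const 2
  rw [shiftMeasure, lintegral_prod _ hm.aemeasurable,
    lintegral_withDensity_eq_lintegral_mul _ (by fun_prop) hm.lintegral_prod_right']
  rfl

theorem ofReal_norm_sq_eq_lintegral {α : Type*} [MeasurableSpace α] {μ : Measure α}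
    (f : Lp ℝ 2 μ) : ENNReal.ofReal (‖f‖ ^ 2) = ∫⁻ z, ‖f z‖ₑ ^ 2 ∂μ := by
  have h1 := eLpNorm_nnreal_pow_eq_lintegral (f := f) (μ := μ) (p := 2) (by norm_num)
  rw [ENNReal.ofReal_pow (norm_nonneg _), ofReal_norm, Lp.enorm_def]
  simpa using h1

theorem measurable_indicator_Ioc (a b : ℝ) : Measurable ((Ioc a b).indicator (1 : ℝ → ℝ)) :=
  measurable_one.indicator measurableSet_Ioc

theorem indicator_Ioc_sub {s t : ℝ} (hs : 0 ≤ s) (hst : s ≤ t) :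
    (Ioc 0 t).indicator (1 : ℝ → ℝ) - (Ioc 0 s).indicator 1 = (Ioc s t).indicator 1 := by
  ext x
  simp only [Pi.sub_apply, indicator, mem_Ioc, Pi.one_apply]
  split_ifs <;> grind

variable {H : ℝ}

theorem memLp_shiftDiff_indicator (hH : 0 < H) (hH' : H < 1 / 2) {t : ℝ} (ht : 0 ≤ t) :
    MemLp (shiftDiff ((Ioc 0 t).indicator 1)) 2 (shiftMeasure H) := by
  refine ⟨(measurable_shiftDiff (measurable_indicator_Ioc 0 t)).aestronglyMeasurable, ?_⟩
  have h1 := eLpNorm_nnreal_pow_eq_lintegral (f := shiftDiff ((Ioc 0 t).indicator 1))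
    (μ := shiftMeasure H) (p := 2) (by norm_num)
  have h2 := lintegral_shiftDiff (measurable_indicator_Ioc 0 t) H
  rw [gagliardo_indicator hH hH' ht] at h2
  have h3 : eLpNorm (shiftDiff ((Ioc 0 t).indicator 1)) 2 (shiftMeasure H) ^ 2 < ⊤ := by
    refine lt_of_eq_of_lt (Eq.trans ?_ h2) ENNReal.ofReal_lt_top
    simpa using h1
  simpa using h3

variable {T : ℝ}

/-- The increments of the indicator of `(0,t]`, as an element of `L²`. -/
def shiftLp (hH : 0 < H) (hH' : H < 1 / 2) (t : Icc (0 : ℝ) T) : Lp ℝ 2 (shiftMeasure H) :=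
  (memLp_shiftDiff_indicator hH hH' t.2.1).toLp _

theorem norm_shiftLp_sub_sq (hH : 0 < H) (hH' : H < 1 / 2) {s t : Icc (0 : ℝ) T} (hst : s ≤ t) :
    ‖shiftLp hH hH' t - shiftLp hH hH' s‖ ^ 2
      = gagliardoConst H * ((t : ℝ) - s) ^ (2 * H) := by
  have h0 : 0 ≤ (t : ℝ) - s := sub_nonneg.2 hst
  have hC := gagliardoConst_pos hH hH'
  rw [← ENNReal.ofReal_eq_ofReal_iff (by positivity) (by positivity),
    ofReal_norm_sq_eq_lintegral, ← gagliardo_indicator hH hH' hst,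
    ← lintegral_shiftDiff (measurable_indicator_Ioc _ _)]
  refine lintegral_congr_ae ?_
  filter_upwards [Lp.coeFn_sub (shiftLp hH hH' t) (shiftLp hH hH' s),
    MemLp.coeFn_toLp (memLp_shiftDiff_indicator hH hH' t.2.1),
    MemLp.coeFn_toLp (memLp_shiftDiff_indicator hH hH' s.2.1)] with z h1 h2 h3
  rw [h1, Pi.sub_apply, shiftLp, shiftLp, h2, h3, ← Pi.sub_apply, ← map_sub]
  rw [indicator_Ioc_sub s.2.1 hst]

/-- The step function `∑ a_t 1_{(0,t]}`. -/
def stepFun : (Icc (0 : ℝ) T →₀ ℝ) →ₗ[ℝ] (ℝ → ℝ) :=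
  Finsupp.linearCombination ℝ fun t => (Ioc (0 : ℝ) t).indicator 1

theorem measurable_stepFun (a : Icc (0 : ℝ) T →₀ ℝ) : Measurable (stepFun a) := by
  induction a using Finsupp.induction_linear with
  | zero =>
    rw [map_zero]
    exact measurable_zero
  | add f g hf hg =>
    rw [map_add]
    exact hf.add hg
  | single t b =>
    rw [stepFun, Finsupp.linearCombination_single]
    exact (measurable_indicator_Ioc _ _).const_smul b

theorem coeFn_linearCombination_shiftLp (hH : 0 < H) (hH' : H < 1 / 2)
    (a : Icc (0 : ℝ) T →₀ ℝ) :
    Finsupp.linearCombination ℝ (shiftLp hH hH') a =ᵐ[shiftMeasure H] shiftDiff (stepFun a) := by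
  induction a using Finsupp.induction_linear with
  | zero =>
    rw [map_zero, map_zero, map_zero]
    exact Lp.coeFn_zero _ _ _
  | add f g hf hg =>
    rw [map_add, map_add, map_add]
    exact (Lp.coeFn_add _ _).trans (hf.add hg)
  | single t b =>
    rw [stepFun, Finsupp.linearCombination_single, Finsupp.linearCombination_single, map_smul]
    exact (Lp.coeFn_smul _ _).trans ((MemLp.coeFn_toLp _).const_smul b)

variable [Fact (0 < T)]

/-- A curve in a Hilbert space that starts at `0` and has squared increments `C |t-s|^{2H}` must
have Gram matrix `C R(s,t)`, by polarisation. -/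
theorem inner_shiftLp (hH : 0 < H) (hH' : H < 1 / 2) (s t : Icc (0 : ℝ) T) :
    inner ℝ (shiftLp hH hH' s) (shiftLp hH hH' t) = gagliardoConst H * fbmCov H s t := by
  have h0 : shiftLp hH hH' (timeZero T) = 0 := by
    rw [Lp.eq_zero_iff_ae_eq_zero]
    filter_upwards [MemLp.coeFn_toLp
      (memLp_shiftDiff_indicator hH hH' (timeZero T).2.1)] with z hz
    rw [shiftLp, hz, show ((timeZero T : Icc (0 : ℝ) T) : ℝ) = 0 from rfl, Ioc_self,
      indicator_empty]
    exact congrFun (map_zero shiftDiff) z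
  have hn : ∀ t : Icc (0 : ℝ) T,
      ‖shiftLp hH hH' t‖ ^ 2 = gagliardoConst H * (t : ℝ) ^ (2 * H) := by
    intro t
    have := norm_shiftLp_sub_sq hH hH' (s := timeZero T) (t := t) t.2.1
    rwa [h0, sub_zero, show ((timeZero T : Icc (0 : ℝ) T) : ℝ) = 0 from rfl, sub_zero] at this
  have hd : ‖shiftLp hH hH' s - shiftLp hH hH' t‖ ^ 2
      = gagliardoConst H * |(t : ℝ) - s| ^ (2 * H) := by
    rcases le_total s t with h | h
    · rw [norm_sub_rev, norm_shiftLp_sub_sq hH hH' h, abs_of_nonneg (sub_nonneg.2 (Subtype.coe_le_coe.2 h))]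
    · rw [norm_shiftLp_sub_sq hH hH' h, abs_sub_comm, abs_of_nonneg (sub_nonneg.2 (Subtype.coe_le_coe.2 h))]
  have h2 := norm_sub_sq_real (shiftLp hH hH' s) (shiftLp hH hH' t)
  rw [hd, hn, hn] at h2
  rw [fbmCov]
  linarith

/-! ### Transfer to the Cameron–Martin space. -/

variable {P : Measure (WienerSpace T)} [IsGaussian P]

/-- The reproducing property: `R(t,·)` is the image under `J` of evaluation at `t`, and pairing that
evaluation with `f` in `L²(P)` evaluates `J f` at `t`. -/
theorem inner_cmKernel_left (t : Icc (0 : ℝ) T) (h : CameronMartin P) :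
    inner ℝ (cmKernel P t) h = (cmIncl P h).1 t := by
  have h1 : inner ℝ (cmKernel P t) h
      = inner ℝ ((cmEquiv P).symm (cmKernel P t)) ((cmEquiv P).symm h) := rfl
  rw [h1, cmKernel, LinearEquiv.symm_apply_apply]
  have h2 := inner_toLp_eq P (wienerEval T t) ((cmEquiv P).symm h : Lp ℝ 2 P)
  rw [← cmIncl_cmEquiv, LinearEquiv.apply_symm_apply] at h2
  exact h2

theorem inner_cmKernel (hP : IsFBMLaw H P) (s t : Icc (0 : ℝ) T) :
    inner ℝ (cmKernel P s) (cmKernel P t) = fbmCov H s t := by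
  rw [real_inner_comm, inner_cmKernel_left, cmKernel_apply P hP]

/-- By construction of the norm, `J` is an isometry from a closed subspace of `L²(P)`. -/
instance instCompleteSpaceCameronMartin : CompleteSpace (CameronMartin P) := by
  have h1 : CompleteSpace (dualClosure P) :=
    (Submodule.isClosed_topologicalClosure _).completeSpace_coe
  have h2 : Isometry (cmEquiv P).symm := (AddMonoidHomClass.isometry_iff_norm _).2 fun h => rfl
  refine (completeSpace_iff_isComplete_range h2.isUniformInducing).2 ?_
  rw [(cmEquiv P).symm.surjective.range_eq]
  exact isComplete_univ

/-- The Gram matrices of the two families are proportional, so the inner products agree up to that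
factor by bilinearity. -/
theorem inner_linearCombination_cmKernel (hH : 0 < H) (hH' : H < 1 / 2) (hP : IsFBMLaw H P)
    (a b : Icc (0 : ℝ) T →₀ ℝ) :
    gagliardoConst H * inner ℝ (Finsupp.linearCombination ℝ (cmKernel P) a)
        (Finsupp.linearCombination ℝ (cmKernel P) b)
      = inner ℝ (Finsupp.linearCombination ℝ (shiftLp hH hH') a)
        (Finsupp.linearCombination ℝ (shiftLp hH hH') b) := by
  induction a using Finsupp.induction_linear with
  | zero => simp
  | add f g hf hg => rw [map_add, map_add, inner_add_left, inner_add_left, mul_add, hf, hg]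
  | single s x =>
    induction b using Finsupp.induction_linear with
    | zero => simp
    | add f g hf hg => rw [map_add, map_add, inner_add_right, inner_add_right, mul_add, hf, hg]
    | single t y =>
      simp only [Finsupp.linearCombination_single, real_inner_smul_left, real_inner_smul_right]
      rw [inner_cmKernel hP, inner_shiftLp]
      ring

/-- The Cameron-Martin norm of `∑ a_t R(t,·)` is the Gagliardo seminorm of `∑ a_t 1_{(0,t]}`. -/
theorem norm_linearCombination_cmKernel_sq (hH : 0 < H) (hH' : H < 1 / 2) (hP : IsFBMLaw H P)
    (a : Icc (0 : ℝ) T →₀ ℝ) :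
    ENNReal.ofReal (gagliardoConst H * ‖Finsupp.linearCombination ℝ (cmKernel P) a‖ ^ 2)
      = gagliardo H (stepFun a) := by
  rw [← real_inner_self_eq_norm_sq, inner_linearCombination_cmKernel hH hH' hP,
    real_inner_self_eq_norm_sq, ofReal_norm_sq_eq_lintegral,
    ← lintegral_shiftDiff (measurable_stepFun a)]
  refine lintegral_congr_ae ?_
  filter_upwards [coeFn_linearCombination_shiftLp hH hH' a] with z hz
  rw [hz]

end Isometry

/-! ## Riemann sums as step functions -/

section Riemann

variable {T : ℝ} [Fact (0 < T)]

theorem IntervalPartition.sub_le_mesh (π : IntervalPartition T) (i : Fin π.size) :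
    (π.pt i.succ : ℝ) - π.pt i.castSucc ≤ π.mesh :=
  le_ciSup (f := fun i : Fin π.size => (π.pt i.succ : ℝ) - π.pt i.castSucc)
    (Set.finite_range _).bddAbove i

theorem IntervalPartition.exists_mem_Ioc (π : IntervalPartition T) {x : ℝ} (hx : x ∈ Ioc 0 T) :
    ∃ i : Fin π.size, x ∈ Ioc (π.pt i.castSucc : ℝ) (π.pt i.succ) := by
  have key : ∀ k : Fin (π.size + 1), x ≤ π.pt k →
      ∃ i : Fin π.size, x ∈ Ioc (π.pt i.castSucc : ℝ) (π.pt i.succ) := by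
    intro k
    induction k using Fin.induction with
    | zero =>
      intro h
      rw [π.first] at h
      exact absurd hx.1 (not_lt.2 h)
    | succ i ih =>
      intro h
      rcases le_or_gt x (π.pt i.castSucc : ℝ) with h' | h'
      · exact ih h'
      · exact ⟨i, h', h⟩
  refine key (Fin.last _) ?_
  rw [π.last]
  exact hx.2

theorem IntervalPartition.index_le (π : IntervalPartition T) {x y : ℝ} (hxy : x ≤ y)
    {i j : Fin π.size} (hi : x ∈ Ioc (π.pt i.castSucc : ℝ) (π.pt i.succ))
    (hj : y ∈ Ioc (π.pt j.castSucc : ℝ) (π.pt j.succ)) : i ≤ j := by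
  by_contra h
  have h1 : π.pt j.succ ≤ π.pt i.castSucc := π.strictMono.monotone (by
    rw [Fin.le_def, Fin.val_succ, Fin.val_castSucc]
    have := not_le.1 h
    rw [Fin.lt_def] at this
    omega)
  have h2 : (π.pt j.succ : ℝ) ≤ π.pt i.castSucc := h1
  linarith [hi.1, hj.2]

theorem TaggedIntervalPartition.tag_mono (π : TaggedIntervalPartition T) : Monotone π.tag := by
  intro i j hij
  rcases hij.eq_or_lt with rfl | hlt
  · exact le_rfl
  · have h1 : π.pt i.succ ≤ π.pt j.castSucc := π.strictMono.monotone (by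
      rw [Fin.le_def, Fin.val_succ, Fin.val_castSucc]
      rw [Fin.lt_def] at hlt
      omega)
    exact (π.tag_mem i).2.le.trans (h1.trans (π.tag_mem j).1.le)

/-- The coefficients of a Riemann sum with respect to the kernels `R(t,·)`. -/
def riemannCoeff (α : Icc (0 : ℝ) T → ℝ) (π : TaggedIntervalPartition T) : Icc (0 : ℝ) T →₀ ℝ :=
  ∑ i : Fin π.size, α (π.tag i) •
    (Finsupp.single (π.pt i.succ) 1 - Finsupp.single (π.pt i.castSucc) 1)

theorem linearCombination_riemannCoeff (P : Measure (WienerSpace T)) [IsGaussian P]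
    (α : Icc (0 : ℝ) T → ℝ) (π : TaggedIntervalPartition T) :
    Finsupp.linearCombination ℝ (cmKernel P) (riemannCoeff α π) = cmRiemannSum P α π := by
  simp only [riemannCoeff, cmRiemannSum, map_sum, map_smul, map_sub,
    Finsupp.linearCombination_single, one_smul]

theorem stepFun_riemannCoeff (α : Icc (0 : ℝ) T → ℝ) (π : TaggedIntervalPartition T) (x : ℝ) :
    stepFun (riemannCoeff α π) x = ∑ i : Fin π.size, α (π.tag i) *
      (Ioc (π.pt i.castSucc : ℝ) (π.pt i.succ)).indicator 1 x := by
  simp only [riemannCoeff, stepFun, map_sum, map_smul, map_sub,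
    Finsupp.linearCombination_single, one_smul, Finset.sum_apply]
  refine Finset.sum_congr rfl fun i _ => ?_
  rw [indicator_Ioc_sub (π.pt i.castSucc).2.1 (π.strictMono i.castSucc_lt_succ).le]
  rfl

theorem stepFun_riemannCoeff_of_mem (α : Icc (0 : ℝ) T → ℝ) (π : TaggedIntervalPartition T)
    {x : ℝ} {i : Fin π.size} (hi : x ∈ Ioc (π.pt i.castSucc : ℝ) (π.pt i.succ)) :
    stepFun (riemannCoeff α π) x = α (π.tag i) := by
  rw [stepFun_riemannCoeff, Finset.sum_eq_single i]
  · rw [indicator_of_mem hi, Pi.one_apply, mul_one]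
  · intro j _ hji
    rw [indicator_of_notMem, mul_zero]
    exact fun hj => hji (le_antisymm (π.index_le le_rfl hj hi) (π.index_le le_rfl hi hj))
  · exact fun h => absurd (Finset.mem_univ i) h

theorem stepFun_riemannCoeff_of_notMem (α : Icc (0 : ℝ) T → ℝ) (π : TaggedIntervalPartition T)
    {x : ℝ} (hx : x ∉ Ioc 0 T) : stepFun (riemannCoeff α π) x = 0 := by
  rw [stepFun_riemannCoeff]
  refine Finset.sum_eq_zero fun i _ => ?_
  rw [indicator_of_notMem, mul_zero]
  exact fun h => hx ⟨(π.pt i.castSucc).2.1.trans_lt h.1, h.2.trans (π.pt i.succ).2.2⟩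

/-- The step function of a Riemann sum is `α ∘ τ` with a monotone `τ`, cut off at time `T`. -/
theorem exists_monotone_stepFun_eq (π : TaggedIntervalPartition T) :
    ∃ τ : ℝ → Icc (0 : ℝ) T, Monotone τ ∧ (∀ x ≤ 0, τ x = timeZero T) ∧
      (∀ x, T < x → τ x = timeEnd T) ∧
      ∀ α : Icc (0 : ℝ) T → ℝ, α (timeZero T) = 0 → stepFun (riemannCoeff α π)
        = (fun x => α (τ x)) - α (timeEnd T) • (Ioi T).indicator 1 := by
  have hT : 0 < T := Fact.out
  choose i hi using fun x : Ioc 0 T => π.exists_mem_Ioc x.2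
  -- On `(0,T]` this is the tag of the cell of `x`; outside it stays at `0` or at `T`, which keeps
  -- it monotone. Past `T` the composition is `α(T)` while the step function is zero, whence the
  -- correction term; left of `0` none is needed since `α(0) = 0`.
  set τ : ℝ → Icc (0 : ℝ) T := fun x =>
    if hx : x ∈ Ioc 0 T then π.tag (i ⟨x, hx⟩) else if x ≤ 0 then timeZero T else timeEnd T with hτ
  have h1 : ∀ x (hx : x ∈ Ioc 0 T), τ x = π.tag (i ⟨x, hx⟩) := fun x hx => by simp only [hτ, hx, dif_pos]
  have h2 : ∀ x ≤ 0, τ x = timeZero T := by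
    intro x hx
    simp only [hτ]
    rw [dif_neg (fun h => absurd h.1 (not_lt.2 hx)), if_pos hx]
  have h3 : ∀ x, T < x → τ x = timeEnd T := by
    intro x hx
    simp only [hτ]
    rw [dif_neg (fun h => absurd h.2 (not_le.2 hx)), if_neg (by linarith)]
  refine ⟨τ, ?_, h2, h3, ?_⟩
  · intro x y hxy
    rcases le_or_gt x 0 with hx | hx
    · rw [h2 x hx]
      exact (τ y).2.1
    rcases lt_or_ge T y with hy | hy
    · rw [h3 y hy]
      exact (τ x).2.2
    rw [h1 x ⟨hx, hxy.trans hy⟩, h1 y ⟨hx.trans_le hxy, hy⟩]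
    exact π.tag_mono (π.index_le hxy (hi _) (hi _))
  · intro α hα
    ext x
    rw [Pi.sub_apply, Pi.smul_apply, smul_eq_mul]
    by_cases hx : x ∈ Ioc 0 T
    · rw [stepFun_riemannCoeff_of_mem α π (hi ⟨x, hx⟩), indicator_of_notMem (by simpa using hx.2),
        h1 x hx, mul_zero, sub_zero]
    · rw [stepFun_riemannCoeff_of_notMem α π hx]
      rcases le_or_gt x 0 with h | h
      · rw [h2 x h, hα, indicator_of_notMem (by simpa using h.trans hT.le)]
        simp
      · have hx' : T < x := by
          by_contra h'
          exact hx ⟨h, not_lt.1 h'⟩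
        rw [h3 x hx', indicator_of_mem (show x ∈ Ioi T from hx'), Pi.one_apply]
        ring

/-! ### From `p`-variation to the `L²` modulus of continuity. -/

theorem shiftSq_indicator_Ioi (T : ℝ) {h : ℝ} (hh : 0 ≤ h) :
    shiftSq ((Ioi T).indicator 1) h = ENNReal.ofReal h := by
  have h1 : ∀ x, ‖(Ioi T).indicator (1 : ℝ → ℝ) (x + h) - (Ioi T).indicator 1 x‖ₑ ^ 2
      = (Ioc (T - h) T).indicator 1 x := by
    intro x
    simp only [indicator, mem_Ioc, mem_Ioi, Pi.one_apply]
    split_ifs <;> first | (exfalso; grind) | simp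
  rw [shiftSq, lintegral_congr h1, lintegral_indicator_one measurableSet_Ioc, Real.volume_Ioc,
    sub_sub_cancel]

/-- Compare `y` with the threshold `h^{1/p}`: below it the first term suffices, above it `y² =
y^{2-p} y^p` and `2 - p ≤ 0`. The threshold is chosen so that, once `y^p` integrates to `O(h)`, both
terms are of order `h^{2/p}`. -/
theorem sq_le_rpow_add_rpow {y h p : ℝ} (hy : 0 ≤ y) (hh : 0 < h) (hp : 2 ≤ p) :
    y ^ 2 ≤ h ^ (2 / p) + h ^ (2 / p - 1) * y ^ p := by
  have hp0 : 0 < p := by linarith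
  have hb : 0 < h ^ (1 / p) := Real.rpow_pos_of_pos hh _
  rcases le_or_gt y (h ^ (1 / p)) with hc | hc
  · have h1 : (h ^ (1 / p)) ^ 2 = h ^ (2 / p) := by
      rw [← Real.rpow_natCast, ← Real.rpow_mul hh.le]
      congr 1
      push_cast
      ring
    have h2 : y ^ 2 ≤ (h ^ (1 / p)) ^ 2 := pow_le_pow_left₀ hy hc 2
    have h3 : 0 ≤ h ^ (2 / p - 1) * y ^ p := by positivity
    linarith
  · have hy0 : 0 < y := hb.trans hc
    have h1 : (h ^ (1 / p)) ^ (p - 2) ≤ y ^ (p - 2) :=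
      Real.rpow_le_rpow hb.le hc.le (by linarith)
    have h2 : h ^ (2 / p - 1) * (h ^ (1 / p)) ^ (p - 2) = 1 := by
      rw [← Real.rpow_mul hh.le, ← Real.rpow_add hh, show 2 / p - 1 + 1 / p * (p - 2) = 0 by
        field_simp; ring, Real.rpow_zero]
    have h3 : y ^ p = y ^ (p - 2) * y ^ 2 := by
      rw [← Real.rpow_natCast y 2, ← Real.rpow_add hy0]
      congr 1
      push_cast
      ring
    have h4 : 1 ≤ h ^ (2 / p - 1) * y ^ (p - 2) :=
      h2.symm.le.trans (mul_le_mul_of_nonneg_left h1 (Real.rpow_nonneg hh.le _))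
    have h5 : 0 ≤ h ^ (2 / p) := by positivity
    rw [h3, ← mul_assoc]
    nlinarith [sq_nonneg y]

theorem enorm_sq_le_rpow_add_rpow (a : ℝ) {h p : ℝ} (hh : 0 < h) (hp : 2 ≤ p) :
    ‖a‖ₑ ^ 2 ≤ ENNReal.ofReal (h ^ (2 / p)) + ENNReal.ofReal (h ^ (2 / p - 1)) * ‖a‖ₑ ^ p := by
  rw [Real.enorm_eq_ofReal_abs, ← ENNReal.ofReal_pow (abs_nonneg a),
    ENNReal.ofReal_rpow_of_nonneg (abs_nonneg a) (by linarith),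
    ← ENNReal.ofReal_mul (by positivity), ← ENNReal.ofReal_add (by positivity) (by positivity)]
  exact ENNReal.ofReal_le_ofReal (sq_le_rpow_add_rpow (abs_nonneg a) hh hp)

theorem shiftSq_comp_monotone_le {p : ℝ} (hp : 2 ≤ p) {α : Icc (0 : ℝ) T → ℝ}
    (hα : pVariation p α ≠ ⊤) {τ : ℝ → Icc (0 : ℝ) T} (hτ : Monotone τ)
    (h0 : ∀ x ≤ 0, τ x = timeZero T) (h1 : ∀ x, T < x → τ x = timeEnd T)
    (hm : Measurable fun x => α (τ x)) {h : ℝ} (hh : 0 < h) :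
    shiftSq (fun x => α (τ x)) h
      ≤ ENNReal.ofReal ((T + h + (pVariation p α ^ p).toReal) * h ^ (2 / p)) := by
  have hT : 0 < T := Fact.out
  have hV : pVariation p α ^ p ≠ ⊤ := ENNReal.rpow_ne_top_of_nonneg (by linarith) hα
  -- The constant term is needed only on `(-h, T]`, the increment being zero elsewhere; without this
  -- cut-off its integral would be infinite.
  have hpt : ∀ x, ‖α (τ (x + h)) - α (τ x)‖ₑ ^ 2
      ≤ (Ioc (-h) T).indicator (fun _ => ENNReal.ofReal (h ^ (2 / p))) x
        + ENNReal.ofReal (h ^ (2 / p - 1)) * ‖α (τ (x + h)) - α (τ x)‖ₑ ^ p := by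
    intro x
    by_cases hx : x ∈ Ioc (-h) T
    · rw [indicator_of_mem hx]
      exact enorm_sq_le_rpow_add_rpow _ hh hp
    · have : τ (x + h) = τ x := by
        rcases le_or_gt x (-h) with hc | hc
        · rw [h0 _ (by linarith), h0 _ (by linarith)]
        · have hx' : T < x := by
            by_contra h'
            exact hx ⟨hc, not_lt.1 h'⟩
          rw [h1 _ hx', h1 _ (by linarith)]
      simp [this]
  calc _ ≤ ∫⁻ x, ((Ioc (-h) T).indicator (fun _ => ENNReal.ofReal (h ^ (2 / p))) x
        + ENNReal.ofReal (h ^ (2 / p - 1)) * ‖α (τ (x + h)) - α (τ x)‖ₑ ^ p) := lintegral_mono hpt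
    _ ≤ ENNReal.ofReal (h ^ (2 / p)) * ENNReal.ofReal (T + h) + ENNReal.ofReal (h ^ (2 / p - 1))
        * (ENNReal.ofReal h * pVariation p α ^ p) := by
      rw [lintegral_add_left (measurable_const.indicator measurableSet_Ioc),
        lintegral_indicator_const measurableSet_Ioc, Real.volume_Ioc, sub_neg_eq_add,
        lintegral_const_mul' _ _ ENNReal.ofReal_ne_top]
      gcongr
      exact lintegral_enorm_rpow_shift_le (by linarith) hτ hm hh
    _ = _ := by
      have hpow : h ^ (2 / p) = h ^ (2 / p - 1) * h := by
        rw [← Real.rpow_add_one hh.ne', sub_add_cancel]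
      have hV' : pVariation p α ^ p = ENNReal.ofReal (pVariation p α ^ p).toReal :=
        (ENNReal.ofReal_toReal hV).symm
      have hV0 : 0 ≤ (pVariation p α ^ p).toReal := ENNReal.toReal_nonneg
      generalize (pVariation p α ^ p).toReal = V at hV' hV0 ⊢
      rw [hV']
      rw [← ENNReal.ofReal_mul (by positivity), ← ENNReal.ofReal_mul (by positivity),
        ← ENNReal.ofReal_mul (by positivity), ← ENNReal.ofReal_add (by positivity) (by positivity),
        hpow]
      congr 1
      ring

/-- The modulus of continuity in `L²` of the step functions of Riemann sums, uniformly in the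
partition. -/
theorem shiftSq_riemann_le {p : ℝ} (hp : 2 ≤ p) {α : Icc (0 : ℝ) T → ℝ}
    (hα : pVariation p α ≠ ⊤) (hα0 : α (timeZero T) = 0) (π : TaggedIntervalPartition T) {h : ℝ}
    (hh : h ∈ Ioc 0 1) :
    shiftSq (stepFun (riemannCoeff α π)) h ≤ ENNReal.ofReal
      (2 * (T + 1 + (pVariation p α ^ p).toReal + α (timeEnd T) ^ 2) * h ^ (2 / p)) := by
  have hT : 0 < T := Fact.out
  obtain ⟨τ, hτ, h0, h1, he⟩ := exists_monotone_stepFun_eq π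
  have he := he α hα0
  have hi : Measurable ((Ioi T).indicator (1 : ℝ → ℝ)) :=
    measurable_one.indicator measurableSet_Ioi
  -- No measurability of `α` is assumed; it is read off from the step function and the jump at `T`.
  have hm : Measurable fun x => α (τ x) := by
    rw [← sub_add_cancel (fun x => α (τ x)) (α (timeEnd T) • (Ioi T).indicator (1 : ℝ → ℝ)), ← he]
    exact (measurable_stepFun _).add (hi.const_smul _)
  -- The jump at `T` contributes `α(T)² h`, which `h ≤ 1` and `p ≥ 2` absorb into the order
  -- `h^{2/p}`.
  have hh1 : h ≤ h ^ (2 / p) := by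
    conv_lhs => rw [← Real.rpow_one h]
    exact Real.rpow_le_rpow_of_exponent_ge hh.1 hh.2 ((div_le_one (by linarith)).2 hp)
  have hb : 0 ≤ h ^ (2 / p) := Real.rpow_nonneg hh.1.le _
  rw [he]
  refine (shiftSq_sub_le hm h).trans ?_
  rw [shiftSq_const_mul, shiftSq_indicator_Ioi T hh.1.le, Real.enorm_eq_ofReal_abs,
    ← ENNReal.ofReal_pow (abs_nonneg _), sq_abs, ← ENNReal.ofReal_mul (sq_nonneg _)]
  have hV : 0 ≤ (pVariation p α ^ p).toReal := ENNReal.toReal_nonneg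
  calc _ ≤ 2 * ENNReal.ofReal ((T + 1 + (pVariation p α ^ p).toReal) * h ^ (2 / p))
        + 2 * ENNReal.ofReal (α (timeEnd T) ^ 2 * h ^ (2 / p)) := by
        gcongr
        refine (shiftSq_comp_monotone_le hp hα hτ h0 h1 hm hh.1).trans ?_
        refine ENNReal.ofReal_le_ofReal ?_
        have := hh.2
        gcongr
    _ = _ := by
        rw [← mul_add, ← ENNReal.ofReal_add (by positivity) (by positivity),
          ← ENNReal.ofReal_ofNat 2, ← ENNReal.ofReal_mul (by norm_num)]
        congr 1
        ring

/-- The point and the tag of its cell are closer than the mesh, so uniform continuity applies. The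
point `0` is left out because it lies in none of the half-open cells. -/
theorem exists_mesh_abs_stepFun_sub_lt {α : Icc (0 : ℝ) T → ℝ} (hα : Continuous α) {η : ℝ}
    (hη : 0 < η) : ∀ᶠ π in meshFilter T, ∀ x : Icc (0 : ℝ) T, 0 < (x : ℝ) →
      |stepFun (riemannCoeff α π) x - α x| < η := by
  obtain ⟨ρ, hρ, hu⟩ := Metric.uniformContinuous_iff.1
    (CompactSpace.uniformContinuous_of_continuous hα) η hη
  have h1 : ∀ᶠ π in meshFilter T, π.toIntervalPartition.mesh < ρ :=
    tendsto_comap.eventually (gt_mem_nhds hρ)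
  filter_upwards [h1] with π hπ x hx
  obtain ⟨i, hi⟩ := π.exists_mem_Ioc (x := x) ⟨hx, x.2.2⟩
  rw [stepFun_riemannCoeff_of_mem α π hi, ← Real.dist_eq]
  refine hu ?_
  rw [Subtype.dist_eq, Real.dist_eq, abs_lt]
  have h2 := π.sub_le_mesh i
  have h3 : (π.pt i.castSucc : ℝ) < π.tag i := (π.tag_mem i).1
  have h4 : (π.tag i : ℝ) < π.pt i.succ := (π.tag_mem i).2
  have h5 := hi.1
  have h6 := hi.2
  constructor <;> linarith

/-- Uniform partitions tagged at midpoints have arbitrarily small mesh. Nontriviality of the filter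
is what makes limits along it unique and Cauchy families meaningful. -/
instance instNeBotMeshFilter : (meshFilter T).NeBot := by
  have hT : 0 < T := Fact.out
  rw [meshFilter, comap_neBot_iff_frequently]
  have h0 : Tendsto (fun n : ℕ => T / ((n : ℝ) + 1)) atTop (𝓝 0) :=
    (tendsto_const_div_atTop_nhds_zero_nat T).comp (tendsto_add_atTop_nat 1) |>.congr
      fun n => by simp
  refine h0.frequently (Eventually.frequently (Eventually.of_forall fun n => ?_))
  have hn : (0 : ℝ) < (n : ℝ) + 1 := by positivity
  set d : ℝ := T / ((n : ℝ) + 1) with hd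
  have hd0 : 0 < d := by positivity
  have hdT : ((n : ℝ) + 1) * d = T := by
    rw [hd]
    field_simp
  have hle : ∀ x : ℝ, x ≤ (n : ℝ) + 1 → x * d ≤ T := fun x hx => by
    rw [← hdT]
    gcongr
  have hi : ∀ i : Fin (n + 1), ((i : ℕ) : ℝ) ≤ n := fun i => by
    exact_mod_cast Nat.lt_succ_iff.1 i.2
  refine ⟨{ size := n + 1
            pt := fun i => ⟨((i : ℕ) : ℝ) * d, by positivity, hle _ (by
              exact_mod_cast Nat.lt_succ_iff.1 i.2)⟩
            strictMono := fun i j hij => Subtype.mk_lt_mk.2 (by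
              have : ((i : ℕ) : ℝ) < ((j : ℕ) : ℝ) := by exact_mod_cast hij
              gcongr)
            first := Subtype.ext (by simp [timeZero])
            last := Subtype.ext (by simpa [timeEnd] using hdT)
            tag := fun i => ⟨(((i : ℕ) : ℝ) + 1 / 2) * d, by positivity, hle _ (by
              linarith [hi i])⟩
            tag_mem := fun i => ⟨Subtype.mk_lt_mk.2 (by
              rw [Fin.val_castSucc]
              nlinarith), Subtype.mk_lt_mk.2 (by
              rw [Fin.val_succ]
              push_cast
              nlinarith)⟩ }, ?_⟩
  refine Eq.trans (iSup_congr fun i => ?_) ciSup_const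
  simp only [Fin.val_succ, Fin.val_castSucc]
  push_cast
  ring

end Riemann

/-! ## Existence and injectivity of the integral -/

theorem lintegral_sq_le_of_abs_le {T : ℝ} {f : ℝ → ℝ} {η : ℝ} (hf : ∀ x ∉ Ioc 0 T, f x = 0)
    (hη : ∀ x ∈ Ioc 0 T, |f x| ≤ η) : ∫⁻ x, ‖f x‖ₑ ^ 2 ≤ ENNReal.ofReal (η ^ 2 * T) := by
  calc _ ≤ ∫⁻ x, (Ioc 0 T).indicator (fun _ => ENNReal.ofReal (η ^ 2)) x := by
        refine lintegral_mono fun x => ?_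
        by_cases hx : x ∈ Ioc 0 T
        · simp only [indicator_of_mem hx]
          rw [Real.enorm_eq_ofReal_abs, ← ENNReal.ofReal_pow (abs_nonneg _)]
          exact ENNReal.ofReal_le_ofReal (pow_le_pow_left₀ (abs_nonneg _) (hη x hx) 2)
        · simp [hf x hx]
    _ = _ := by
        rw [lintegral_indicator_const measurableSet_Ioc, Real.volume_Ioc, sub_zero,
          ← ENNReal.ofReal_mul (sq_nonneg _)]

section Integral

variable {T : ℝ} [Fact (0 < T)]

theorem sum_sub_eq_last_sub_first {n : ℕ} (v : Fin (n + 1) → ℝ) :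
    ∑ i : Fin n, (v i.succ - v i.castSucc) = v (Fin.last n) - v 0 := by
  have h1 := Fin.sum_univ_succ v
  have h2 := Fin.sum_univ_castSucc v
  rw [Finset.sum_sub_distrib]
  linarith

/-- An increment `x ≤ K T` satisfies `x^p ≤ (K T)^{p-1} x`, and the linear bounds `K (t_i -
t_{i-1})` telescope. -/
theorem pVariation_lt_top_of_lipschitz {p : ℝ} (hp : 1 ≤ p) {f : Icc (0 : ℝ) T → ℝ} {K : ℝ}
    (hK : 0 ≤ K) (hf : ∀ s t, |f t - f s| ≤ K * |(t : ℝ) - s|) : pVariation p f < ⊤ := by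
  have hT : 0 < T := Fact.out
  refine lt_of_le_of_lt (iSup_le fun π => ?_)
    (ENNReal.rpow_lt_top_of_nonneg (y := 1 / p) (by positivity)
      (ENNReal.ofReal_ne_top (r := (K * T) ^ (p - 1) * (K * T))))
  refine ENNReal.rpow_le_rpow ?_ (by positivity)
  have hd : ∀ i : Fin π.size, 0 ≤ (π.pt i.succ : ℝ) - π.pt i.castSucc := fun i =>
    sub_nonneg.2 (Subtype.coe_le_coe.2 (π.strictMono i.castSucc_lt_succ).le)
  calc _ ≤ ∑ i : Fin π.size, ENNReal.ofReal
        ((K * T) ^ (p - 1) * (K * ((π.pt i.succ : ℝ) - π.pt i.castSucc))) := by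
        refine Finset.sum_le_sum fun i _ => ?_
        rw [Real.enorm_eq_ofReal_abs, ENNReal.ofReal_rpow_of_nonneg (abs_nonneg _) (by linarith)]
        refine ENNReal.ofReal_le_ofReal ?_
        have h1 := hf (π.pt i.castSucc) (π.pt i.succ)
        rw [abs_of_nonneg (hd i)] at h1
        set x := K * ((π.pt i.succ : ℝ) - π.pt i.castSucc) with hx
        have hx0 : 0 ≤ x := mul_nonneg hK (hd i)
        have hxT : x ≤ K * T := by
          refine mul_le_mul_of_nonneg_left ?_ hK
          linarith [(π.pt i.succ).2.2, (π.pt i.castSucc).2.1]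
        calc _ ≤ x ^ p := Real.rpow_le_rpow (abs_nonneg _) h1 (by linarith)
          _ = x ^ (p - 1) * x := by
            rw [← Real.rpow_add_one' hx0 (by linarith), sub_add_cancel]
          _ ≤ _ := mul_le_mul_of_nonneg_right
            (Real.rpow_le_rpow hx0 hxT (by linarith)) hx0
    _ = _ := by
      rw [← ENNReal.ofReal_sum_of_nonneg (fun i _ => mul_nonneg (by positivity)
        (mul_nonneg hK (hd i))), ← Finset.mul_sum, ← Finset.mul_sum,
        sum_sub_eq_last_sub_first (fun i => (π.pt i : ℝ)), π.first, π.last]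
      simp [timeEnd, timeZero]

/-- Compare with a smooth path at distance less than one, which is Lipschitz on the compact
interval. -/
theorem pVariation_lt_top_of_mem {p : ℝ} [hp : Fact (1 ≤ p)] {ω : WienerSpace T}
    (hω : ω ∈ WienerP T p) : pVariation p ⇑ω.1 < ⊤ := by
  obtain ⟨g, ⟨G, hG, hgG⟩, hlt⟩ := hω 1 one_pos
  obtain ⟨K, hK⟩ := hG.exists_lipschitzOnWith (by simp) (convex_Icc 0 T) isCompact_Icc
  have h1 : pVariation p ⇑g.1 < ⊤ := by
    refine pVariation_lt_top_of_lipschitz hp.out K.2 fun s t => ?_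
    rw [hgG, hgG, ← Real.dist_eq, ← Real.dist_eq]
    exact hK.dist_le_mul _ t.2 _ s.2
  have h2 : (⇑ω.1 : Icc (0 : ℝ) T → ℝ) = ⇑(ω - g).1 + ⇑g.1 := by
    ext t
    simp
  rw [h2]
  exact (pVariation_add_le hp.out _ _).trans_lt
    (ENNReal.add_lt_top.2 ⟨hlt.trans ENNReal.one_lt_top, h1⟩)

variable {H p : ℝ} {P : Measure (WienerSpace T)} [IsGaussian P]

/-- The seminorm of the difference of the two step functions is split at `h = δ`: the first term
uses the uniform modulus of continuity, the second that both functions are `η`-close to `α`. The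
factor `8` is `2·2 + 2·2` from the increments; `16` is the `4` of the tail estimate times the square
of `2η`. -/
theorem norm_cmRiemannSum_sub_sq_le (hH : 0 < H) (hH' : H < 1 / 2) (hP : IsFBMLaw H P)
    (hp : 2 ≤ p) (hκ : 1 - 2 * H < 2 / p) {α : Icc (0 : ℝ) T → ℝ} (hα : pVariation p α ≠ ⊤)
    (hα0 : α (timeZero T) = 0) {δ η : ℝ} (hδ : δ ∈ Ioc 0 1)
    (π π' : TaggedIntervalPartition T)
    (h1 : ∀ x : Icc (0 : ℝ) T, 0 < (x : ℝ) → |stepFun (riemannCoeff α π) x - α x| < η)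
    (h2 : ∀ x : Icc (0 : ℝ) T, 0 < (x : ℝ) → |stepFun (riemannCoeff α π') x - α x| < η) :
    gagliardoConst H * ‖cmRiemannSum P α π - cmRiemannSum P α π'‖ ^ 2
      ≤ 8 * (T + 1 + (pVariation p α ^ p).toReal + α (timeEnd T) ^ 2)
          * (δ ^ (2 * H - 1 + 2 / p) / (2 * H - 1 + 2 / p))
        + δ ^ (2 * H - 1) / (1 - 2 * H) * (16 * T) * η ^ 2 := by
  have hT : 0 < T := Fact.out
  have hV : 0 ≤ (pVariation p α ^ p).toReal := ENNReal.toReal_nonneg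
  have hδ0 := hδ.1
  have hH1 : 0 < 1 - 2 * H := by linarith
  have hκ1 : 0 < 2 * H - 1 + 2 / p := by linarith
  set A := T + 1 + (pVariation p α ^ p).toReal + α (timeEnd T) ^ 2 with hA
  have hA0 : 0 ≤ A := by positivity
  set f := stepFun (riemannCoeff α π)
  set g := stepFun (riemannCoeff α π')
  have hm : Measurable (f - g) := (measurable_stepFun _).sub (measurable_stepFun _)
  have hs : ∀ h ∈ Ioc 0 δ, shiftSq (f - g) h ≤ ENNReal.ofReal (8 * A * h ^ (2 / p)) := by
    intro h hh
    have hh' : h ∈ Ioc (0 : ℝ) 1 := ⟨hh.1, hh.2.trans hδ.2⟩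
    have h0 : 0 ≤ h ^ (2 / p) := Real.rpow_nonneg hh.1.le _
    calc _ ≤ _ := shiftSq_sub_le (measurable_stepFun _) h
      _ ≤ 2 * ENNReal.ofReal (2 * A * h ^ (2 / p)) + 2 * ENNReal.ofReal (2 * A * h ^ (2 / p)) := by
        gcongr <;> exact shiftSq_riemann_le hp hα hα0 _ hh'
      _ = _ := by
        rw [← add_mul, show (2 : ℝ≥0∞) + 2 = ENNReal.ofReal 4 by norm_num,
          ← ENNReal.ofReal_mul (by norm_num)]
        congr 1
        ring
  have hL : ∫⁻ x, ‖(f - g) x‖ₑ ^ 2 ≤ ENNReal.ofReal ((2 * η) ^ 2 * T) := by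
    refine lintegral_sq_le_of_abs_le (fun x hx => ?_) fun x hx => ?_
    · rw [Pi.sub_apply]
      simp only [f, g]
      rw [stepFun_riemannCoeff_of_notMem α π hx, stepFun_riemannCoeff_of_notMem α π' hx, sub_zero]
    · have h3 := abs_lt.1 (h1 ⟨x, hx.1.le, hx.2⟩ hx.1)
      have h4 := abs_lt.1 (h2 ⟨x, hx.1.le, hx.2⟩ hx.1)
      rw [Pi.sub_apply, abs_le]
      constructor <;> linarith [h3.1, h3.2, h4.1, h4.2]
  have key : ENNReal.ofReal (gagliardoConst H * ‖cmRiemannSum P α π - cmRiemannSum P α π'‖ ^ 2)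
      = gagliardo H (f - g) := by
    rw [← linearCombination_riemannCoeff, ← linearCombination_riemannCoeff, ← map_sub,
      norm_linearCombination_cmKernel_sq hH hH' hP, map_sub]
  rw [← ENNReal.ofReal_le_ofReal_iff (by positivity), key]
  refine (gagliardo_le_of_shiftSq_le hH' hκ hδ0 (by positivity) hm hs).trans ?_
  rw [ENNReal.ofReal_add (by positivity) (by positivity)]
  refine add_le_add le_rfl ?_
  calc _ ≤ ENNReal.ofReal (δ ^ (2 * H - 1) / (1 - 2 * H))
        * (4 * ENNReal.ofReal ((2 * η) ^ 2 * T)) := by gcongr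
    _ = _ := by
      rw [show (4 : ℝ≥0∞) = ENNReal.ofReal 4 by norm_num, ← ENNReal.ofReal_mul (by norm_num),
        ← ENNReal.ofReal_mul (by positivity)]
      congr 1
      ring

theorem exists_tendsto_cmRiemannSum (hH : 0 < H) (hH' : H < 1 / 2) (hP : IsFBMLaw H P)
    (hp : 2 ≤ p) (hκ : 1 - 2 * H < 2 / p) {α : Icc (0 : ℝ) T → ℝ} (hc : Continuous α)
    (hα : pVariation p α ≠ ⊤) (hα0 : α (timeZero T) = 0) :
    ∃ I : CameronMartin P, Tendsto (cmRiemannSum P α) (meshFilter T) (𝓝 I) := by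
  have hC := gagliardoConst_pos hH hH'
  have hκ1 : 0 < 2 * H - 1 + 2 / p := by linarith
  refine cauchy_map_iff_exists_tendsto.1 (Metric.cauchy_iff.2 ⟨inferInstance, fun ε hε => ?_⟩)
  have hε' : 0 < gagliardoConst H * ε ^ 2 / 2 := by positivity
  -- The order matters: `δ` makes the small-step term small for all partitions, and only then is `η`
  -- chosen, since its factor `δ^{2H-1}` blows up as `δ` tends to `0`.
  obtain ⟨δ, hδ, hδ1⟩ : ∃ δ ∈ Ioc (0 : ℝ) 1,
      8 * (T + 1 + (pVariation p α ^ p).toReal + α (timeEnd T) ^ 2)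
          * (δ ^ (2 * H - 1 + 2 / p) / (2 * H - 1 + 2 / p)) < gagliardoConst H * ε ^ 2 / 2 := by
    have ht : Tendsto (fun δ : ℝ => 8 * (T + 1 + (pVariation p α ^ p).toReal
        + α (timeEnd T) ^ 2) * (δ ^ (2 * H - 1 + 2 / p) / (2 * H - 1 + 2 / p))) (𝓝[>] 0)
        (𝓝 (8 * (T + 1 + (pVariation p α ^ p).toReal + α (timeEnd T) ^ 2)
          * (0 ^ (2 * H - 1 + 2 / p) / (2 * H - 1 + 2 / p)))) :=
      (((Real.continuousAt_rpow_const 0 _ (Or.inr hκ1.le)).tendsto.mono_left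
        nhdsWithin_le_nhds).div_const _).const_mul _
    rw [Real.zero_rpow hκ1.ne', zero_div, mul_zero] at ht
    obtain ⟨δ, h1, h2⟩ := ((ht.eventually (gt_mem_nhds hε')).and
      (Ioc_mem_nhdsGT (zero_lt_one' ℝ))).exists
    exact ⟨δ, h2, h1⟩
  obtain ⟨η, hη, hη1⟩ : ∃ η > 0,
      δ ^ (2 * H - 1) / (1 - 2 * H) * (16 * T) * η ^ 2 < gagliardoConst H * ε ^ 2 / 2 := by
    have ht : Tendsto (fun η : ℝ => δ ^ (2 * H - 1) / (1 - 2 * H) * (16 * T) * η ^ 2) (𝓝[>] 0)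
        (𝓝 (δ ^ (2 * H - 1) / (1 - 2 * H) * (16 * T) * 0 ^ 2)) :=
      (((continuous_pow 2).tendsto (0 : ℝ)).mono_left nhdsWithin_le_nhds).const_mul _
    rw [zero_pow two_ne_zero, mul_zero] at ht
    obtain ⟨η, h1, h2⟩ := ((ht.eventually (gt_mem_nhds hε')).and
      self_mem_nhdsWithin).exists
    exact ⟨η, h2, h1⟩
  refine ⟨_, image_mem_map (exists_mesh_abs_stepFun_sub_lt hc hη), ?_⟩
  rintro _ ⟨π, hπ, rfl⟩ _ ⟨π', hπ', rfl⟩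
  have h1 := norm_cmRiemannSum_sub_sq_le hH hH' hP hp hκ hα hα0 hδ π π' hπ hπ'
  rw [dist_eq_norm]
  have h2 : ‖cmRiemannSum P α π - cmRiemannSum P α π'‖ ^ 2 < ε ^ 2 := by
    refine lt_of_mul_lt_mul_left (h1.trans_lt ?_) hC.le
    linarith
  exact lt_of_pow_lt_pow_left₀ 2 hε.le h2

/-- A continuous function whose integral is a multiple of `R(T,·)` is constant. -/
theorem eq_const_of_tendsto_cmRiemannSum (hH : 0 < H) (hH' : H < 1 / 2) (hP : IsFBMLaw H P)
    {α : Icc (0 : ℝ) T → ℝ} (hα : Continuous α) {c : ℝ}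
    (ht : Tendsto (cmRiemannSum P α) (meshFilter T) (𝓝 (c • cmKernel P (timeEnd T)))) :
    ∀ t, α t = c := by
  have hT : 0 < T := Fact.out
  set D := (2 * T) ^ (2 * H - 2) * T with hD
  have hD0 : 0 < D := by positivity
  set β : ℝ → ℝ := IccExtend hT.le α with hβ
  have hβc : Continuous β := hα.Icc_extend'
  set X := ∫⁻ x in Ioc 0 T, ‖β x - c‖ₑ ^ 2 with hX
  have hbound : ∀ η > 0, ∀ᶠ π in meshFilter T, ENNReal.ofReal D * X ≤
      ENNReal.ofReal (2 * D * (η ^ 2 * T) + 2 * (gagliardoConst H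
        * ‖cmRiemannSum P α π - c • cmKernel P (timeEnd T)‖ ^ 2)) := by
    intro η hη
    filter_upwards [exists_mesh_abs_stepFun_sub_lt hα hη] with π hπ
    have hC := gagliardoConst_pos hH hH'
    -- The kernel `R(T,·)` corresponds to `1_{(0,T]}`, so this combination represents the error in
    -- the Cameron–Martin space and has a step function close to `α - c` on `(0,T]`.
    set a : Icc (0 : ℝ) T →₀ ℝ := riemannCoeff α π - Finsupp.single (timeEnd T) c with ha
    have hga : Finsupp.linearCombination ℝ (cmKernel P) a
        = cmRiemannSum P α π - c • cmKernel P (timeEnd T) := by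
      rw [ha, map_sub, linearCombination_riemannCoeff, Finsupp.linearCombination_single]
    have hfa : ∀ x, stepFun a x = stepFun (riemannCoeff α π) x - c * (Ioc 0 T).indicator 1 x := by
      intro x
      rw [ha, map_sub, Pi.sub_apply]
      congr 1
      rw [stepFun, Finsupp.linearCombination_single]
      rfl
    have hlow := lintegral_sq_le_gagliardo hH' hT (f := stepFun a) (fun x hx => by
      rw [hfa, stepFun_riemannCoeff_of_notMem α π hx, indicator_of_notMem hx]
      simp)
    rw [← norm_linearCombination_cmKernel_sq hH hH' hP, hga] at hlow
    have hX1 : X ≤ 2 * ENNReal.ofReal (η ^ 2 * T) + 2 * ∫⁻ x, ‖stepFun a x‖ₑ ^ 2 := by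
      calc X ≤ ∫⁻ x in Ioc 0 T, (2 * ENNReal.ofReal (η ^ 2) + 2 * ‖stepFun a x‖ₑ ^ 2) := by
            refine setLIntegral_mono' measurableSet_Ioc fun x hx => ?_
            have h1 := hπ ⟨x, hx.1.le, hx.2⟩ hx.1
            have h2 : β x = α ⟨x, hx.1.le, hx.2⟩ := IccExtend_of_mem hT.le α ⟨hx.1.le, hx.2⟩
            have h3 : β x - c = (α ⟨x, hx.1.le, hx.2⟩ - stepFun (riemannCoeff α π) x)
                + stepFun a x := by
              rw [hfa, h2, indicator_of_mem hx, Pi.one_apply]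
              ring
            rw [h3]
            refine (enorm_add_sq_le _ _).trans ?_
            gcongr
            rw [Real.enorm_eq_ofReal_abs, ← ENNReal.ofReal_pow (abs_nonneg _), abs_sub_comm]
            exact ENNReal.ofReal_le_ofReal (pow_le_pow_left₀ (abs_nonneg _) h1.le 2)
        _ = 2 * ENNReal.ofReal (η ^ 2 * T) + 2 * ∫⁻ x in Ioc 0 T, ‖stepFun a x‖ₑ ^ 2 := by
            rw [lintegral_add_left measurable_const, setLIntegral_const, Real.volume_Ioc, sub_zero,
              lintegral_const_mul' _ _ (by norm_num), mul_assoc,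
              ← ENNReal.ofReal_mul (sq_nonneg _)]
        _ ≤ _ := by
            gcongr
            exact Measure.restrict_le_self
    calc _ ≤ ENNReal.ofReal D * (2 * ENNReal.ofReal (η ^ 2 * T)
          + 2 * ∫⁻ x, ‖stepFun a x‖ₑ ^ 2) := by gcongr
      _ = ENNReal.ofReal (2 * D * (η ^ 2 * T))
          + 2 * (ENNReal.ofReal D * ∫⁻ x, ‖stepFun a x‖ₑ ^ 2) := by
        rw [mul_add, mul_left_comm _ 2 (∫⁻ x, ‖stepFun a x‖ₑ ^ 2), mul_left_comm _ 2,
          ← ENNReal.ofReal_mul hD0.le, ← ENNReal.ofReal_ofNat 2, ← ENNReal.ofReal_mul (by norm_num)]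
        congr 2
        ring
      _ ≤ ENNReal.ofReal (2 * D * (η ^ 2 * T)) + 2 * ENNReal.ofReal (gagliardoConst H
          * ‖cmRiemannSum P α π - c • cmKernel P (timeEnd T)‖ ^ 2) := by gcongr
      _ = _ := by
        rw [← ENNReal.ofReal_ofNat 2, ← ENNReal.ofReal_mul (by norm_num),
          ← ENNReal.ofReal_add (by positivity) (by positivity)]
  -- The mesh tends to zero with `η` fixed, which removes the Cameron–Martin error; afterwards `η`
  -- tends to zero.
  have hX2 : ∀ η > 0, ENNReal.ofReal D * X ≤ ENNReal.ofReal (2 * D * (η ^ 2 * T)) := by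
    intro η hη
    refine ge_of_tendsto ?_ (hbound η hη)
    have h1 := (((((ht.sub_const (c • cmKernel P (timeEnd T))).norm).pow 2).const_mul
      (gagliardoConst H)).const_mul 2).const_add (2 * D * (η ^ 2 * T))
    simpa using ENNReal.tendsto_ofReal h1
  have hX3 : X = 0 := by
    have h1 : Tendsto (fun η : ℝ => ENNReal.ofReal (2 * D * (η ^ 2 * T))) (𝓝[>] 0)
        (𝓝 (ENNReal.ofReal (2 * D * (0 ^ 2 * T)))) :=
      ENNReal.tendsto_ofReal ((((continuous_pow 2).tendsto (0 : ℝ)).mono_left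
        nhdsWithin_le_nhds).mul_const _ |>.const_mul _)
    have h2 := ge_of_tendsto h1 (eventually_nhdsWithin_of_forall fun η hη => hX2 η hη)
    have h3 : ENNReal.ofReal D ≠ 0 := by simpa using hD0
    simpa [h3] using h2
  have hae : β =ᵐ[volume.restrict (Icc 0 T)] fun _ => c := by
    rw [hX, lintegral_eq_zero_iff (by fun_prop), Measure.restrict_congr_set Ioc_ae_eq_Icc] at hX3
    filter_upwards [hX3] with x hx
    simpa [sub_eq_zero] using hx
  intro t
  have h1 := Measure.eqOn_Icc_of_ae_eq volume hT.ne hae hβc.continuousOn continuousOn_const t.2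
  rwa [hβ, IccExtend_val] at h1

end Integral

/-! ## The form as a sum of squares -/

section Form

variable {T : ℝ} [Fact (0 < T)] {P : Measure (WienerSpace T)} [IsGaussian P]

/-- The integral as a linear map on a space of paths on which it exists. -/
def integralLin (V : Submodule ℝ (WienerSpace T)) (hV : ∀ α : V, ∃ I : CameronMartin P,
    Tendsto (cmRiemannSum P (α : WienerSpace T).1) (meshFilter T) (𝓝 I)) :
    V →ₗ[ℝ] CameronMartin P where
  toFun α := cmIntegral P (α : WienerSpace T).1
  map_add' α β := by
    obtain ⟨I, hI⟩ := hV α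
    obtain ⟨J, hJ⟩ := hV β
    have h1 : Tendsto (cmRiemannSum P ((α + β : V) : WienerSpace T).1) (meshFilter T)
        (𝓝 (I + J)) := by
      refine (hI.add hJ).congr fun π => ?_
      simp [cmRiemannSum, add_smul, Finset.sum_add_distrib]
    rw [cmIntegral, cmIntegral, cmIntegral, hI.limUnder_eq, hJ.limUnder_eq, h1.limUnder_eq]
  map_smul' c α := by
    obtain ⟨I, hI⟩ := hV α
    have h1 : Tendsto (cmRiemannSum P ((c • α : V) : WienerSpace T).1) (meshFilter T)
        (𝓝 (c • I)) := by
      refine (hI.const_smul c).congr fun π => ?_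
      simp [cmRiemannSum, mul_smul, Finset.smul_sum]
    rw [cmIntegral, cmIntegral, hI.limUnder_eq, h1.limUnder_eq, RingHom.id_apply]

/-- A component of `Q` as a linear map. -/
def qLin (V : Submodule ℝ (WienerSpace T)) (hV : ∀ α : V, ∃ I : CameronMartin P,
    Tendsto (cmRiemannSum P (α : WienerSpace T).1) (meshFilter T) (𝓝 I)) :
    V →ₗ[ℝ] CameronMartin P :=
  (1 / 2 : ℝ) • ((wienerEval T (timeEnd T)).toLinearMap.comp V.subtype).smulRight
    (cmKernel P (timeEnd T)) - integralLin V hV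

theorem qLin_apply (V : Submodule ℝ (WienerSpace T)) (hV : ∀ α : V, ∃ I : CameronMartin P,
    Tendsto (cmRiemannSum P (α : WienerSpace T).1) (meshFilter T) (𝓝 I)) (α : V) :
    qLin V hV α = qComponent P (α : WienerSpace T) := by
  rw [qComponent, mul_smul]
  rfl

/-- The component of `h` orthogonal to `R(T,·)`, scaled by `T^{2H}`. -/
def orthPart (H : ℝ) (P : Measure (WienerSpace T)) [IsGaussian P] :
    CameronMartin P →ₗ[ℝ] CameronMartin P :=
  T ^ (2 * H) • LinearMap.id
    - ((innerₗ (CameronMartin P)) (cmKernel P (timeEnd T))).smulRight (cmKernel P (timeEnd T))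

theorem orthPart_apply (H : ℝ) (h : CameronMartin P) :
    orthPart H P h = T ^ (2 * H) • h
      - (cmIncl P h).1 (timeEnd T) • cmKernel P (timeEnd T) := by
  rw [← inner_cmKernel_left]
  rfl

/-- Expand the square: the cross term is `-2 T^{2H} h(T)²` by the reproducing property and the last
term is `T^{2H} h(T)²`, as `‖R(T,·)‖² = R(T,T) = T^{2H}`. -/
theorem norm_orthPart_sq {H : ℝ} (hH : 0 < H) (hP : IsFBMLaw H P) (h : CameronMartin P) :
    ‖orthPart H P h‖ ^ 2 = T ^ (4 * H) * ‖h‖ ^ 2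
      - T ^ (2 * H) * (cmIncl P h).1 (timeEnd T) ^ 2 := by
  have hT : 0 < T := Fact.out
  have hK : ‖cmKernel P (timeEnd T)‖ ^ 2 = T ^ (2 * H) := by
    rw [← real_inner_self_eq_norm_sq, inner_cmKernel hP, fbmCov, sub_self, abs_zero,
      Real.zero_rpow (by linarith)]
    simp [timeEnd]
  have hT4 : T ^ (4 * H) = T ^ (2 * H) * T ^ (2 * H) := by
    rw [← Real.rpow_add hT]
    congr 1
    ring
  rw [orthPart_apply, norm_sub_sq_real, norm_smul, norm_smul, real_inner_smul_left,
    real_inner_smul_right, real_inner_comm, inner_cmKernel_left, mul_pow, mul_pow, hK, hT4,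
    Real.norm_eq_abs, Real.norm_eq_abs, sq_abs, sq_abs]
  ring

/-- The square identity is applied to each component. The swap and the sign in `ω̃` do not matter,
since the component maps are linear and norms are even. -/
theorem formPhi_eq {H p : ℝ} [Fact (1 ≤ p)] (hH : 0 < H) (hP : IsFBMLaw H P)
    (hV : ∀ α : WienerP T p, ∃ I : CameronMartin P,
      Tendsto (cmRiemannSum P (α : WienerSpace T).1) (meshFilter T) (𝓝 I))
    (ω : WienerP T p × WienerP T p) :
    formPhi H P ω = ‖orthPart H P (qLin _ hV ω.2)‖ ^ 2
      + ‖orthPart H P (qLin _ hV ω.1)‖ ^ 2 := by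
  have h1 : qComponent P (-ω.1 : WienerSpace T) = -qLin _ hV ω.1 := by
    rw [← map_neg, qLin_apply]
    rfl
  rw [← norm_neg (orthPart H P (qLin _ hV ω.1)), ← map_neg, ← h1, qLin_apply,
    norm_orthPart_sq hH hP, norm_orthPart_sq hH hP, formPhi, WithLp.prod_norm_sq_eq_of_L2,
    EuclideanSpace.norm_sq_eq, Fin.sum_univ_two]
  simp only [endValue, opQ, Real.norm_eq_abs, sq_abs]
  simp only [WithLp.toLp_fst, WithLp.toLp_snd, Matrix.cons_val_zero, Matrix.cons_val_one]
  ring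

end Form

end

/-! ### Assembly of the theorem. -/

theorem lemma3p11 (H T p : ℝ) (hH : 1 / 3 < H) (hH' : H < 1 / 2) [Fact (0 < T)]
    [Fact (1 ≤ p)] (hp : 1 / H < p) (hp' : p < 1 / (1 - 2 * H))
    (P : Measure (WienerSpace T)) [IsGaussian P] (hP : IsFBMLaw H P) :
    (∀ α : WienerP T p, ∃ I : CameronMartin P,
      Tendsto (cmRiemannSum P (α : WienerSpace T).1) (meshFilter T) (𝓝 I)) ∧
    (∃ q : QuadraticForm ℝ (WienerP T p × WienerP T p), ∀ ω, q ω = formPhi H P ω) ∧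
    (∀ ω : WienerP T p × WienerP T p, 0 ≤ formPhi H P ω) ∧
    (∀ ω : WienerP T p × WienerP T p, formPhi H P ω = 0 ↔ ω = 0) := by

  have hH0 : 0 < H := by linarith
  have hp2 : 2 ≤ p := by
    refine le_trans ?_ hp.le
    rw [le_div_iff₀ hH0]
    linarith
  -- The bound on `p` says `p (1 - 2H) < 1`, which is more than the `p (1 - 2H) < 2` needed for
  -- convergence.
  have hκ : 1 - 2 * H < 2 / p := by
    have h1 : 0 < 1 - 2 * H := by linarith
    rw [lt_div_iff₀ h1] at hp'
    rw [lt_div_iff₀ (by linarith)]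
    linarith
  have hV : ∀ α : WienerP T p, ∃ I : CameronMartin P,
      Tendsto (cmRiemannSum P (α : WienerSpace T).1) (meshFilter T) (𝓝 I) := fun α =>
    exists_tendsto_cmRiemannSum hH0 hH' hP hp2 hκ α.1.1.continuous
      (pVariation_lt_top_of_mem α.2).ne α.1.2
  have hker : ∀ α : WienerP T p, orthPart H P (qLin _ hV α) = 0 → α = 0 := by
    intro α hα
    have hT : 0 < T ^ (2 * H) := Real.rpow_pos_of_pos Fact.out _
    obtain ⟨I, hI⟩ := hV α
    -- A vanishing orthogonal part makes the component of `Q` a multiple of `R(T,·)`; its boundary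
    -- term is one as well, hence so is the integral.
    obtain ⟨c, rfl⟩ : ∃ c : ℝ, I = c • cmKernel P (timeEnd T) := by
      rw [orthPart_apply, sub_eq_zero] at hα
      generalize (cmIncl P (qLin _ hV α)).1 (timeEnd T) = r at hα
      rw [qLin_apply, qComponent, cmIntegral, hI.limUnder_eq, ← eq_inv_smul_iff₀ hT.ne',
        sub_eq_iff_eq_add, ← sub_eq_iff_eq_add', smul_smul, ← sub_smul] at hα
      exact ⟨_, hα.symm⟩
    have h1 := eq_const_of_tendsto_cmRiemannSum hH0 hH' hP α.1.1.continuous hI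
    have h0 : α.1.1 (timeZero T) = 0 := α.1.2
    refine Subtype.ext (Subtype.ext (ContinuousMap.ext fun t => ?_))
    rw [h1 t, ← h1 (timeZero T), h0]
    rfl
  refine ⟨hV, ?_, ?_, ?_⟩
  · have hq : ∀ L : (WienerP T p × WienerP T p) →ₗ[ℝ] CameronMartin P,
        ∃ q : QuadraticForm ℝ (WienerP T p × WienerP T p), ∀ ω, q ω = ‖L ω‖ ^ 2 := fun L =>
      ⟨(LinearMap.BilinMap.toQuadraticMap (innerₗ (CameronMartin P))).comp L, fun ω =>
        real_inner_self_eq_norm_sq (L ω)⟩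
    obtain ⟨q₁, h₁⟩ := hq (orthPart H P ∘ₗ qLin _ hV ∘ₗ LinearMap.snd ℝ _ _)
    obtain ⟨q₂, h₂⟩ := hq (orthPart H P ∘ₗ qLin _ hV ∘ₗ LinearMap.fst ℝ _ _)
    refine ⟨q₁ + q₂, fun ω => ?_⟩
    rw [add_apply, h₁, h₂, formPhi_eq hH0 hP hV]
    rfl
  · intro ω
    rw [formPhi_eq hH0 hP hV]
    positivity
  · intro ω
    rw [formPhi_eq hH0 hP hV]
    constructor
    · intro h
      rw [add_eq_zero_iff_of_nonneg (sq_nonneg _) (sq_nonneg _), sq_eq_zero_iff, norm_eq_zero,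
        sq_eq_zero_iff, norm_eq_zero] at h
      exact Prod.ext (hker _ h.2) (hker _ h.1)
    · rintro rfl
      simp
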